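/- **Conventions.** For groups $G,H$, the wreath product $G\wr H$ is the group of pairs $(f,x)$ with $f:H\to G$ finitely supported and $x\in H$, with $(f,x)(g,y)=(z\mapsto f(z)\,g(x^{-1}z),\,xy)$. If $S$ and $T$ are finite generating sets of $G$ and $H$, then $G$, $H$ and $G\wr H$ carry the left-invariant word metrics $d$ with respect to $S$, $T$ and $\{(1,t):t\in T\}\cup\{(\delta_s,1):s\in S\}$ respectively, where $\delta_s(1_H)=s$ and $\delta_s(z)=1_G$ for $z\ne 1_H$. Write $L_p=L_p([0,1])$ with Lebesgue measure. A *modulus* is a nondecreasing unbounded function $[0,\infty)\to[0,\infty)$. A metric space $X$ *coarsely embeds* into a Banach space $E$ if there are a map $F:X\to E$ and moduli $\rho_1,\rho_2$ with $\rho_1(d(x,y))\le\|F(x)-F(y)\|\le\rho_2(d(x,y))$ for all $x,y\in X$. **Theorem 1.2.** Let $G,H$ be groups with finite generating sets $S,T$, and let $1\le p<\infty$. (a) If $G$ and $H$ coarsely embed into $L_1$, then $G\wr H$ coarsely embeds into $L_p$. (b) Let $\psi:H\to L_1$ and $\phi:G\to L_1$ be maps and $\rho_1,\rho_2,\tau_1,\tau_2$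 moduli such that $$\rho_1(d(x,y))\le\|\psi(x)-\psi(y)\|_1\le\rho_2(d(x,y))\quad(x,y\in H),\qquad \tau_1(d(x,y))\le\|\phi(x)-\phi(y)\|_1\le\tau_2(d(x,y))\quad(x,y\in G).$$ For integers $t\ge 0$ put $\nu_2(t)=t^{\max\{1/2,1/p\}}$ and $$\nu_1(t)=\left[\min\left\{\sqrt{\min\left\{\sum_{k=1}^n\rho_1(s_k): s_k\ge 0,\ \sum_{k=1}^n s_k=t_1\right\}}+\sum_{j=2}^m\tau_1(t_j): t_j\ge 0,\ \sum_{j=1}^m t_j=t\right\}\right]^{\max\{1/2,1/p\}},$$ where the $s_k$ and $t_j$ are integers and $n,m$ are arbitrary. Then there are a map $\Phi:G\wr H\to L_p$ and constants $c,C>0$ such that for all $u,v\in G\wr H$ $$c\,\nu_1(d(u,v))\le\|\Phi(u)-\Phi(v)\|_p\le C\,\nu_2(d(u,v)).$$ (c) In the situation of (b), $\nu_1$ is nondecreasing on the nonnegative integers. If $\rho_1(1)>0$ and $\tau_1(1)>0$, then $\nu_1$ is unbounded. If $\rho_1$ and $\tau_1$ are strictly increasing, then $\nu_1$ is strictly increasing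 and unbounded. -/

import Mathlib

open MeasureTheory
open scoped NNReal ENNReal

/-- The wreath product `G ≀ H`: the pairs `(f, x)` with `f : H → G` finitely supported and `x : H`,
as a subgroup of the unrestricted regular wreath product. The multiplication inherited from Mathlib
is `(f, x) * (g, y) = (z ↦ f z * g (x⁻¹ * z), x * y)`. -/
def WreathProduct (G H : Type*) [Group G] [Group H] : Subgroup (RegularWreathProduct G H) where
  carrier := {w | (Function.mulSupport w.left).Finite}
  one_mem' := by simp
  mul_mem' := by
    intro a b ha hb
    simp only [Set.mem_ofPred_eq, RegularWreathProduct.mul_left] at *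
    refine (ha.union (hb.preimage
      ((mul_right_injective (a.right⁻¹)).injOn))).subset ?_
    exact Function.mulSupport_mul _ _
  inv_mem' := by
    intro a ha
    simp only [Set.mem_ofPred_eq, RegularWreathProduct.inv_left] at *
    refine (ha.preimage ((mul_right_injective a.right).injOn)).subset ?_
    intro z hz
    simpa using hz

open scoped Classical in
/-- The standard generating set of `G ≀ H` attached to `S ⊆ G` and `T ⊆ H`: the elements `(1, t)`
with `t ∈ T` and the elements `(δ_s, 1)` with `s ∈ S`, where `δ_s` takes the value `s` at the
identity of `H` and is trivial elsewhere. -/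
def wreathGenerators {G H : Type*} [Group G] [Group H] (S : Set G) (T : Set H) :
    Set (WreathProduct G H) :=
  {w | (∃ t ∈ T, (w : RegularWreathProduct G H) = ⟨1, t⟩) ∨
    (∃ s ∈ S, (w : RegularWreathProduct G H) = ⟨Pi.mulSingle 1 s, 1⟩)}

/-- The word length of `g` with respect to `S`: the least length of a word in the elements of `S`
and their inverses that represents `g`. -/
noncomputable def wordLength {G : Type*} [Group G] (S : Set G) (g : G) : ℕ :=
  sInf {n | ∃ l : List G, (∀ a ∈ l, a ∈ S ∨ a⁻¹ ∈ S) ∧ l.prod = g ∧ l.length = n}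

/-- The left-invariant word metric. -/
noncomputable def wordDist {G : Type*} [Group G] (S : Set G) (x y : G) : ℕ :=
  wordLength S (x⁻¹ * y)

/-- The Banach space `L_p = L_p([0,1])` with Lebesgue measure. -/
abbrev LpSpace (p : ℝ≥0∞) : Type :=
  Lp ℝ p (volume : Measure unitInterval)

/-- An increasing (that is, nondecreasing) unbounded function `ℝ₊ → ℝ₊`. -/
def IsModulus (ρ : ℝ≥0 → ℝ≥0) : Prop :=
  Monotone ρ ∧ ¬ BddAbove (Set.range ρ)

/-- `ρ₁(d(x, y)) ≤ ‖f x - f y‖ ≤ ρ₂(d(x, y))` for all `x, y`. -/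
def HasCompressionBounds {X E : Type*} [NormedAddCommGroup E] (d : X → X → ℕ) (f : X → E)
    (ρ₁ ρ₂ : ℝ≥0 → ℝ≥0) : Prop :=
  ∀ x y, ρ₁ (d x y) ≤ ‖f x - f y‖₊ ∧ ‖f x - f y‖₊ ≤ ρ₂ (d x y)

/-- The space `X` with the integer-valued metric `d` embeds coarsely into the Banach space `E`. -/
def CoarselyEmbeds {X : Type*} (d : X → X → ℕ) (E : Type*) [NormedAddCommGroup E] : Prop :=
  ∃ (f : X → E) (ρ₁ ρ₂ : ℝ≥0 → ℝ≥0),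
    IsModulus ρ₁ ∧ IsModulus ρ₂ ∧ HasCompressionBounds d f ρ₁ ρ₂

/-- `min {∑ₖ ρ(sₖ) : sₖ ≥ 0, ∑ₖ sₖ = t}`, over all finite lists of nonnegative integers with
sum `t`. -/
noncomputable def partitionMin (ρ : ℝ≥0 → ℝ≥0) (t : ℕ) : ℝ≥0 :=
  sInf {r | ∃ s : List ℕ, s.sum = t ∧ r = (s.map fun k => ρ k).sum}

/-- `min {√(partitionMin ρ t₁) + ∑_{j ≥ 2} τ(tⱼ) : tⱼ ≥ 0, ∑_{j ≥ 1} tⱼ = t}`, over all finite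
nonempty lists `t₁, t₂, …, tₘ` of nonnegative integers with sum `t`. -/
noncomputable def wreathPartitionMin (ρ τ : ℝ≥0 → ℝ≥0) (t : ℕ) : ℝ≥0 :=
  sInf {r | ∃ (t₁ : ℕ) (l : List ℕ), t₁ + l.sum = t ∧
    r = NNReal.sqrt (partitionMin ρ t₁) + (l.map fun k => τ k).sum}

/-- The exponent `max {1/2, 1/p}`. -/
noncomputable def compressionExponent (p : ℝ≥0∞) : ℝ :=
  max (1 / 2) (1 / p.toReal)

/-- The lower modulus `ν₁`. -/
noncomputable def lowerModulus (p : ℝ≥0∞) (ρ τ : ℝ≥0 → ℝ≥0) (t : ℕ) : ℝ≥0 :=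
  wreathPartitionMin ρ τ t ^ compressionExponent p

/-- The upper modulus `ν₂(t) = t ^ max {1/2, 1/p}`. -/
noncomputable def upperModulus (p : ℝ≥0∞) (t : ℕ) : ℝ≥0 :=
  (t : ℝ≥0) ^ compressionExponent p

/-!
The embedding is built from cuts. A map into `L₁` amounts to a measure on the cuts of its domain:
the distance `‖ψ x - ψ y‖₁` is the measure of the symmetric difference of the subgraphs of `ψ x` and
`ψ y` (`isCutKernel_enorm_sub`). Conversely, if `K x y` is the measure of the symmetric difference of
`A x` and `A y`, then the indicator functions of the sets `A x` realise `K ^ (1 / q)` as a distance in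
`L_q`, and every `σ`-finite standard Borel space can be replaced by `[0,1]`
(`IsCutKernel.exists_map_Lp`). For `p ≤ 2` this is used with `q = p`; for `p > 2` it is used with
`q = 2` and followed by a Gaussian embedding of `L₂` into `L_p` (`exists_map_L2_Lp`). Hence it suffices
to find one cut kernel `N` on `G ≀ H` with
`wreathPartitionMin ρ₁ τ₁ (d(u, v)) ≤ N u v ≤ C * d(u, v)` (`WreathProduct.exists_cutKernel`).

A cut of `H` with sides `B`, `Bᶜ` is lifted to the cuts of `G ≀ H` that consist of the `(g, x)` with
`x ∈ B` and prescribed values of `g` off `B` (`WreathProduct.liftCut`), and likewise for `Bᶜ`. Changing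
the lamp at the cursor crosses none of these, and moving the cursor from `x` to `y` crosses two of them
if the cut separates `x` from `y`, and none otherwise. On the other hand a cut that separates two
active points of `u`, `v` (cursors, or lamps in different states) has a lift that separates `u` from
`v`. So the lift `M` of the kernel of `ψ` is bounded on generators, and `M u v` bounds
`‖ψ a - ψ b‖₁` for all active points `a`, `b` (`WreathProduct.exists_liftKernel`).

To `M` one adds `‖φ (g z) - φ (g' z)‖₁` summed over the lamps `z`, the number `n` of lamps in different
states, and a discrete kernel; all of these are bounded on generators, which gives the upper bound. For
the lower bound, `u` and `v` are joined by a word that walks through the `n` points where the lamps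
differ (`WreathProduct.isWordOfLengthLE_of_path`). The `n + 1` steps of the walk have
`∑ ρ₁(sₖ) ≤ (n + 1) * M u v`, and `√((n + 1) * M u v) ≤ n + 1 + M u v`; this is where the square root
in the lower modulus comes from.

The properties of the lower modulus follow from lowering one part of a partition by one
(`exists_partition_of_succ`) and from the observation that a partition of a large number has a large
part or many parts (`IsModulus.exists_le_sum_partition`).
-/

/-! ### Partition minima and the lower modulus -/

/-- The sums in `partitionMin` and `wreathPartitionMin` are taken over the list of the parts cast to
`ℝ≥0`, which is written as a monadic bind. -/
theorem map_bind_natCast (f : ℝ≥0 → ℝ≥0) (s : List ℕ) :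
    (List.map (fun k => f k) (s >>= fun a => pure (a : ℝ≥0))) = s.map fun k : ℕ => f k := by
  induction s with
  | nil => rfl
  | cons a s ih => simpa using ih

theorem partitionMin_le (ρ : ℝ≥0 → ℝ≥0) (s : List ℕ) :
    partitionMin ρ s.sum ≤ (s.map fun k : ℕ => ρ k).sum :=
  csInf_le' ⟨s, rfl, by rw [map_bind_natCast]⟩

theorem le_partitionMin {ρ : ℝ≥0 → ℝ≥0} {t : ℕ} {b : ℝ≥0}
    (h : ∀ s : List ℕ, s.sum = t → b ≤ (s.map fun k : ℕ => ρ k).sum) : b ≤ partitionMin ρ t := by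
  refine le_csInf ⟨_, [t], by simp, rfl⟩ ?_
  rintro _ ⟨s, hs, rfl⟩
  rw [map_bind_natCast]
  exact h s hs

theorem wreathPartitionMin_le (ρ τ : ℝ≥0 → ℝ≥0) (t₁ : ℕ) (l : List ℕ) :
    wreathPartitionMin ρ τ (t₁ + l.sum) ≤
      NNReal.sqrt (partitionMin ρ t₁) + (l.map fun k : ℕ => τ k).sum :=
  csInf_le' ⟨t₁, l, rfl, by rw [map_bind_natCast]⟩

theorem le_wreathPartitionMin {ρ τ : ℝ≥0 → ℝ≥0} {t : ℕ} {b : ℝ≥0}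
    (h : ∀ (t₁ : ℕ) (l : List ℕ), t₁ + l.sum = t →
      b ≤ NNReal.sqrt (partitionMin ρ t₁) + (l.map fun k : ℕ => τ k).sum) :
    b ≤ wreathPartitionMin ρ τ t := by
  refine le_csInf ⟨_, t, [], by simp, rfl⟩ ?_
  rintro _ ⟨t₁, l, hl, rfl⟩
  rw [map_bind_natCast]
  exact h t₁ l hl

theorem partitionMin_zero (ρ : ℝ≥0 → ℝ≥0) : partitionMin ρ 0 = 0 :=
  le_antisymm (by simpa using partitionMin_le ρ []) bot_le

theorem wreathPartitionMin_zero (ρ τ : ℝ≥0 → ℝ≥0) : wreathPartitionMin ρ τ 0 = 0 :=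
  le_antisymm (by simpa [partitionMin_zero] using wreathPartitionMin_le ρ τ 0 []) bot_le

/-- Lowering one positive part of a partition of `t + 1` by one lowers the cost by at least `ε`, if
`f` grows by at least `ε` between consecutive integers up to `t + 1`. The case `ε = 0` gives
monotonicity of the partition minima, the case `ε > 0` strict monotonicity. -/
theorem exists_partition_of_succ {f : ℕ → ℝ≥0} {t : ℕ} {ε : ℝ≥0}
    (hf : ∀ k ≤ t, f k + ε ≤ f (k + 1)) (s : List ℕ) (hs : s.sum = t + 1) :
    ∃ s' : List ℕ, s'.sum = t ∧ (s'.map f).sum + ε ≤ (s.map f).sum := by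
  induction s with
  | nil => simp at hs
  | cons a s ih =>
    rw [List.sum_cons] at hs
    rcases a with _ | k
    · obtain ⟨s', h1, h2⟩ := ih (by omega)
      refine ⟨0 :: s', by simpa using h1, ?_⟩
      simp only [List.map_cons, List.sum_cons, add_assoc]
      gcongr
    · refine ⟨k :: s, by simp; omega, ?_⟩
      simp only [List.map_cons, List.sum_cons]
      calc f k + (s.map f).sum + ε = f k + ε + (s.map f).sum := by ring
        _ ≤ _ := by gcongr; exact hf k (by omega)

theorem partitionMin_add_le_succ {ρ : ℝ≥0 → ℝ≥0} {t : ℕ} {ε : ℝ≥0}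
    (hρ : ∀ k : ℕ, k ≤ t → ρ k + ε ≤ ρ (k + 1 : ℕ)) :
    partitionMin ρ t + ε ≤ partitionMin ρ (t + 1) := by
  refine le_partitionMin fun s hs => ?_
  obtain ⟨s', rfl, h⟩ := exists_partition_of_succ (f := fun k => ρ k) hρ s hs
  exact (add_le_add_left (partitionMin_le ρ s') ε).trans h

theorem wreathPartitionMin_add_le_succ {ρ τ : ℝ≥0 → ℝ≥0} {t : ℕ} {ε : ℝ≥0}
    (hρ : ∀ k ≤ t, NNReal.sqrt (partitionMin ρ k) + ε ≤ NNReal.sqrt (partitionMin ρ (k + 1)))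
    (hτ : ∀ k : ℕ, k ≤ t → τ k + ε ≤ τ (k + 1 : ℕ)) :
    wreathPartitionMin ρ τ t + ε ≤ wreathPartitionMin ρ τ (t + 1) := by
  refine le_wreathPartitionMin fun t₁ l hl => ?_
  rcases t₁ with _ | k
  · obtain ⟨l', h1, h2⟩ := exists_partition_of_succ (f := fun k => τ k) hτ l (by omega)
    have := wreathPartitionMin_le ρ τ 0 l'
    rw [zero_add, h1] at this
    calc wreathPartitionMin ρ τ t + ε
        ≤ NNReal.sqrt (partitionMin ρ 0) + (l'.map fun k : ℕ => τ k).sum + ε := by gcongr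
      _ = NNReal.sqrt (partitionMin ρ 0) + ((l'.map fun k : ℕ => τ k).sum + ε) := by ring
      _ ≤ _ := by gcongr
  · have := wreathPartitionMin_le ρ τ k l
    rw [show k + l.sum = t by omega] at this
    calc wreathPartitionMin ρ τ t + ε
        ≤ NNReal.sqrt (partitionMin ρ k) + (l.map fun k : ℕ => τ k).sum + ε := by gcongr
      _ = NNReal.sqrt (partitionMin ρ k) + ε + (l.map fun k : ℕ => τ k).sum := by ring
      _ ≤ _ := by gcongr; exact hρ k (by omega)

theorem partitionMin_mono {ρ : ℝ≥0 → ℝ≥0} (hρ : Monotone ρ) : Monotone (partitionMin ρ) := by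
  refine monotone_nat_of_le_succ fun t => ?_
  simpa using partitionMin_add_le_succ (ρ := ρ) (t := t) (ε := 0) fun k _ => by
    simpa using hρ (by simp)

theorem wreathPartitionMin_mono {ρ τ : ℝ≥0 → ℝ≥0} (hρ : Monotone ρ) (hτ : Monotone τ) :
    Monotone (wreathPartitionMin ρ τ) := by
  refine monotone_nat_of_le_succ fun t => ?_
  simpa using wreathPartitionMin_add_le_succ (ρ := ρ) (τ := τ) (t := t) (ε := 0)
    (fun k _ => by simpa using partitionMin_mono hρ (Nat.le_succ k))
    fun k _ => by simpa using hτ (by simp)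

theorem StrictMono.exists_uniform_gap {f : ℕ → ℝ≥0} (hf : StrictMono f) (t : ℕ) :
    ∃ ε > 0, ∀ k ≤ t, f k + ε ≤ f (k + 1) := by
  induction t with
  | zero =>
    refine ⟨f 1 - f 0, tsub_pos_of_lt (hf one_pos), fun k hk => ?_⟩
    obtain rfl : k = 0 := by omega
    exact (add_tsub_cancel_of_le (hf one_pos).le).le
  | succ t ih =>
    obtain ⟨ε, hε, h⟩ := ih
    have hlt : f (t + 1) < f (t + 1 + 1) := hf (Nat.lt_succ_self _)
    refine ⟨min ε (f (t + 1 + 1) - f (t + 1)), lt_min hε (tsub_pos_of_lt hlt), fun k hk => ?_⟩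
    rcases Nat.le_succ_iff.1 hk with hk | rfl
    · exact (add_le_add_right (min_le_left _ _) _).trans (h k hk)
    · exact (add_le_add_right (min_le_right _ _) _).trans (add_tsub_cancel_of_le hlt.le).le

theorem partitionMin_strictMono {ρ : ℝ≥0 → ℝ≥0} (hρ : StrictMono ρ) :
    StrictMono (partitionMin ρ) := by
  refine strictMono_nat_of_lt_succ fun t => ?_
  obtain ⟨ε, hε, h⟩ := (hρ.comp (Nat.strictMono_cast (α := ℝ≥0))).exists_uniform_gap t
  exact (lt_add_of_pos_right _ hε).trans_le (partitionMin_add_le_succ h)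

theorem wreathPartitionMin_strictMono {ρ τ : ℝ≥0 → ℝ≥0} (hρ : StrictMono ρ) (hτ : StrictMono τ) :
    StrictMono (wreathPartitionMin ρ τ) := by
  refine strictMono_nat_of_lt_succ fun t => ?_
  obtain ⟨ε, hε, h⟩ := (hτ.comp (Nat.strictMono_cast (α := ℝ≥0))).exists_uniform_gap t
  obtain ⟨δ, hδ, h'⟩ :=
    (NNReal.sqrt.strictMono.comp (partitionMin_strictMono hρ)).exists_uniform_gap t
  exact (lt_add_of_pos_right _ (lt_min hδ hε)).trans_le <| wreathPartitionMin_add_le_succ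
    (fun k hk => (add_le_add_right (min_le_left _ _) _).trans (h' k hk))
    fun k hk => (add_le_add_right (min_le_right _ _) _).trans (h k hk)

theorem IsModulus.exists_nat_ge {ρ : ℝ≥0 → ℝ≥0} (hρ : IsModulus ρ) (B : ℝ≥0) :
    ∃ N : ℕ, B ≤ ρ N := by
  obtain ⟨_, ⟨x, rfl⟩, hx⟩ := not_bddAbove_iff.1 hρ.2 B
  exact ⟨⌈x⌉₊, hx.le.trans (hρ.1 (Nat.le_ceil x))⟩

/-- A partition of a large number has either a large part or many nonzero parts. -/
theorem IsModulus.exists_le_sum_partition {ρ : ℝ≥0 → ℝ≥0} (hρ : IsModulus ρ) (h1 : 0 < ρ 1)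
    (B : ℝ≥0) : ∃ N : ℕ, ∀ s : List ℕ, N ≤ s.sum → B ≤ (s.map fun k : ℕ => ρ k).sum := by
  obtain ⟨N₀, hN₀⟩ := hρ.exists_nat_ge B
  refine ⟨⌈(N₀ + 1) * B / ρ 1⌉₊, fun s hs => ?_⟩
  by_cases hbig : ∃ a ∈ s, N₀ ≤ a
  · obtain ⟨a, ha, hle⟩ := hbig
    calc B ≤ ρ N₀ := hN₀
      _ ≤ ρ a := hρ.1 (by exact_mod_cast hle)
      _ ≤ _ := List.single_le_sum (fun _ _ => zero_le) _ (List.mem_map.2 ⟨a, ha, rfl⟩)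
  · push Not at hbig
    -- A part `a ≤ N₀` satisfies `a * ρ 1 ≤ (N₀ + 1) * ρ a`.
    have key : ∀ l : List ℕ, (∀ a ∈ l, a < N₀) →
        (l.sum : ℝ≥0) * ρ 1 ≤ (N₀ + 1) * (l.map fun k : ℕ => ρ k).sum := by
      intro l hl
      induction l with
      | nil => simp
      | cons a l ih =>
        simp only [List.sum_cons, List.map_cons, Nat.cast_add, add_mul, mul_add]
        have h2 := ih fun b hb => hl b (List.mem_cons_of_mem _ hb)
        have h3 : (a : ℝ≥0) * ρ 1 ≤ (N₀ + 1) * ρ a := by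
          rcases a with _ | a
          · simp
          · have : a + 1 < N₀ := hl _ (by simp)
            have h4 : ((a + 1 : ℕ) : ℝ≥0) ≤ N₀ + 1 := by exact_mod_cast (by omega)
            exact mul_le_mul' h4 (hρ.1 (by simp))
        calc _ ≤ (N₀ + 1) * ρ a + (N₀ + 1) * (l.map fun k : ℕ => ρ k).sum := by
              gcongr
          _ = _ := by ring
    have h3 : (N₀ + 1) * B / ρ 1 ≤ (s.sum : ℝ≥0) := Nat.ceil_le.1 hs
    rw [div_le_iff₀ h1] at h3
    exact le_of_mul_le_mul_left (h3.trans (key s hbig)) (by positivity)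

theorem not_bddAbove_range_wreathPartitionMin {ρ τ : ℝ≥0 → ℝ≥0} (hρ : IsModulus ρ)
    (hτ : IsModulus τ) (hρ1 : 0 < ρ 1) (hτ1 : 0 < τ 1) :
    ¬ BddAbove (Set.range (wreathPartitionMin ρ τ)) := by
  rintro ⟨B, hB⟩
  obtain ⟨N, hN⟩ := hρ.exists_le_sum_partition hρ1 ((B + 1) ^ 2)
  obtain ⟨N', hN'⟩ := hτ.exists_le_sum_partition hτ1 (B + 1)
  have h : B + 1 ≤ wreathPartitionMin ρ τ (N + N') := by
    refine le_wreathPartitionMin fun t₁ l hl => ?_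
    rcases le_total N t₁ with h | h
    · refine le_add_right ?_
      rw [NNReal.le_sqrt_iff_sq_le]
      exact le_partitionMin fun s hs => hN s (hs ▸ h)
    · exact le_add_left (hN' l (by omega))
  exact (lt_add_one B).not_ge (h.trans (hB ⟨_, rfl⟩))

theorem compressionExponent_pos (p : ℝ≥0∞) : 0 < compressionExponent p :=
  lt_max_of_lt_left (by norm_num)

theorem monotone_lowerModulus (p : ℝ≥0∞) {ρ τ : ℝ≥0 → ℝ≥0} (hρ : Monotone ρ) (hτ : Monotone τ) :
    Monotone (lowerModulus p ρ τ) :=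
  (NNReal.monotone_rpow_of_nonneg (compressionExponent_pos p).le).comp
    (wreathPartitionMin_mono hρ hτ)

theorem strictMono_lowerModulus (p : ℝ≥0∞) {ρ τ : ℝ≥0 → ℝ≥0} (hρ : StrictMono ρ)
    (hτ : StrictMono τ) : StrictMono (lowerModulus p ρ τ) :=
  (NNReal.strictMono_rpow_of_pos (compressionExponent_pos p)).comp
    (wreathPartitionMin_strictMono hρ hτ)

theorem not_bddAbove_range_lowerModulus (p : ℝ≥0∞) {ρ τ : ℝ≥0 → ℝ≥0} (hρ : IsModulus ρ)
    (hτ : IsModulus τ) (hρ1 : 0 < ρ 1) (hτ1 : 0 < τ 1) :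
    ¬ BddAbove (Set.range (lowerModulus p ρ τ)) := by
  rintro ⟨B, hB⟩
  refine not_bddAbove_range_wreathPartitionMin hρ hτ hρ1 hτ1 ⟨B ^ (compressionExponent p)⁻¹, ?_⟩
  rintro _ ⟨t, rfl⟩
  rw [NNReal.le_rpow_inv_iff (compressionExponent_pos p)]
  exact hB ⟨t, rfl⟩

/-! ### Words -/

/-- `g` is represented by a word of length at most `n` in the elements of `S` and their inverses. -/
def IsWordOfLengthLE {G : Type*} [Group G] (S : Set G) (g : G) (n : ℕ) : Prop :=
  ∃ l : List G, (∀ a ∈ l, a ∈ S ∨ a⁻¹ ∈ S) ∧ l.prod = g ∧ l.length ≤ n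

section Words

variable {G : Type*} [Group G] {S : Set G}

namespace IsWordOfLengthLE

theorem mono {g : G} {m n : ℕ} (h : IsWordOfLengthLE S g m) (hmn : m ≤ n) :
    IsWordOfLengthLE S g n := by
  obtain ⟨l, h1, h2, h3⟩ := h
  exact ⟨l, h1, h2, h3.trans hmn⟩

theorem one : IsWordOfLengthLE S (1 : G) 0 := ⟨[], by simp, rfl, le_rfl⟩

theorem mul {g h : G} {m n : ℕ} (hg : IsWordOfLengthLE S g m) (hh : IsWordOfLengthLE S h n) :
    IsWordOfLengthLE S (g * h) (m + n) := by
  obtain ⟨l, h1, h2, h3⟩ := hg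
  obtain ⟨l', h1', h2', h3'⟩ := hh
  refine ⟨l ++ l', fun a ha => (List.mem_append.1 ha).elim (h1 a) (h1' a), by simp [h2, h2'], ?_⟩
  rw [List.length_append]
  omega

theorem map {G' : Type*} [Group G'] {S' : Set G'} (f : G →* G') (hf : Set.MapsTo f S S') {g : G}
    {n : ℕ} (hg : IsWordOfLengthLE S g n) : IsWordOfLengthLE S' (f g) n := by
  obtain ⟨l, h1, rfl, h3⟩ := hg
  refine ⟨l.map f, fun a ha => ?_, (map_list_prod f l).symm, by simpa using h3⟩
  obtain ⟨b, hb, rfl⟩ := List.mem_map.1 ha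
  exact (h1 b hb).imp (fun h => hf h) fun h => map_inv f b ▸ hf h

theorem wordLength_le {g : G} {n : ℕ} (hg : IsWordOfLengthLE S g n) : wordLength S g ≤ n := by
  obtain ⟨l, h1, h2, h3⟩ := hg
  exact le_trans (Nat.sInf_le (show l.length ∈ _ from ⟨l, h1, h2, rfl⟩)) h3

theorem exists_wordLength {g : G} {n : ℕ} (hg : IsWordOfLengthLE S g n) :
    ∃ l : List G, (∀ a ∈ l, a ∈ S ∨ a⁻¹ ∈ S) ∧ l.prod = g ∧ l.length = wordLength S g := by
  obtain ⟨l, h1, h2, -⟩ := hg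
  exact Nat.sInf_mem (s := {n | ∃ l : List G, (∀ a ∈ l, a ∈ S ∨ a⁻¹ ∈ S) ∧ l.prod = g ∧
    l.length = n}) ⟨l.length, l, h1, h2, rfl⟩

end IsWordOfLengthLE

theorem exists_word_of_closure_eq_top (hS : Subgroup.closure S = ⊤) (g : G) :
    ∃ l : List G, (∀ a ∈ l, a ∈ S ∨ a⁻¹ ∈ S) ∧ l.prod = g := by
  have h : g ∈ (Subgroup.closure S).toSubmonoid := hS ▸ Subgroup.mem_top g
  rw [Subgroup.closure_toSubmonoid] at h
  simpa using Submonoid.exists_list_of_mem_closure h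

theorem isWordOfLengthLE_wordLength (hS : Subgroup.closure S = ⊤) (g : G) :
    IsWordOfLengthLE S g (wordLength S g) := by
  obtain ⟨l, h1, h2⟩ := exists_word_of_closure_eq_top hS g
  obtain ⟨l', h1, h2, h3⟩ := IsWordOfLengthLE.exists_wordLength ⟨l, h1, h2, le_rfl⟩
  exact ⟨l', h1, h2, h3.le⟩

theorem wordLength_le_one {a : G} (ha : a ∈ S) : wordLength S a ≤ 1 :=
  IsWordOfLengthLE.wordLength_le ⟨[a], by simp [ha], by simp, by simp⟩

theorem wordDist_self (x : G) : wordDist S x x = 0 :=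
  Nat.le_zero.1 (IsWordOfLengthLE.wordLength_le (by simpa using IsWordOfLengthLE.one))

theorem countable_of_closure_eq_top (hSfin : S.Finite) (hS : Subgroup.closure S = ⊤) :
    Countable G := by
  have : Countable {a | a ∈ S ∨ a⁻¹ ∈ S} := by
    refine Set.Countable.to_subtype ?_
    exact (hSfin.countable.union (hSfin.countable.preimage inv_injective))
  have hsurj : Function.Surjective
      fun l : List {a | a ∈ S ∨ a⁻¹ ∈ S} => (l.map Subtype.val).prod := by
    intro g
    obtain ⟨l, h1, h2⟩ := exists_word_of_closure_eq_top hS g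
    refine ⟨l.attachWith (· ∈ {a | a ∈ S ∨ a⁻¹ ∈ S}) h1, ?_⟩
    rw [← h2]
    exact congrArg List.prod (List.attachWith_map_subtype_val h1)
  exact hsurj.countable

end Words

/-! ### Words in the wreath product -/

namespace WreathProduct

variable {G H : Type*} [Group G] [Group H]

@[ext]
theorem ext {u v : WreathProduct G H} (h : ∀ z, u.1.left z = v.1.left z)
    (h' : u.1.right = v.1.right) : u = v :=
  Subtype.ext (RegularWreathProduct.ext (funext h) h')

/-- The embedding `t ↦ (1, t)`: moving the cursor. -/
def cursor : H →* WreathProduct G H where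
  toFun t := ⟨⟨1, t⟩, by simp [WreathProduct]⟩
  map_one' := rfl
  map_mul' a b := by ext <;> simp

open scoped Classical in
/-- The embedding `s ↦ (δ_s, 1)`: changing the lamp at the cursor. -/
noncomputable def lamp : G →* WreathProduct G H where
  toFun s := ⟨⟨Pi.mulSingle 1 s, 1⟩,
    (Set.finite_singleton (1 : H)).subset Pi.mulSupport_mulSingle_subset⟩
  map_one' := by ext <;> simp
  map_mul' a b := by ext <;> simp [Pi.mulSingle_mul]

theorem left_mul_cursor (u : WreathProduct G H) (t : H) :
    (u * cursor t).1.left = u.1.left := by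
  ext z; simp [cursor]

theorem right_mul_cursor (u : WreathProduct G H) (t : H) :
    (u * cursor t).1.right = u.1.right * t := rfl

open scoped Classical in
theorem left_mul_lamp (u : WreathProduct G H) (s : G) :
    (u * lamp s).1.left =
      Function.update u.1.left u.1.right (u.1.left u.1.right * s) := by
  ext z
  by_cases h : z = u.1.right
  · subst h; simp [lamp]
  · have : u.1.right⁻¹ * z ≠ 1 := fun h' => h (inv_mul_eq_one.1 h').symm
    simp [lamp, h, this]

theorem right_mul_lamp (u : WreathProduct G H) (s : G) :
    (u * lamp s).1.right = u.1.right := by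
  simp [lamp]

theorem mapsTo_cursor (S : Set G) (T : Set H) :
    Set.MapsTo cursor T (wreathGenerators S T) := fun t ht => .inl ⟨t, ht, rfl⟩

theorem mapsTo_lamp (S : Set G) (T : Set H) :
    Set.MapsTo lamp S (wreathGenerators S T) := fun s hs => .inr ⟨s, hs, rfl⟩

theorem mem_wreathGenerators {S : Set G} {T : Set H} {w : WreathProduct G H} :
    w ∈ wreathGenerators S T ↔ (∃ t ∈ T, cursor t = w) ∨ ∃ s ∈ S, lamp s = w := by
  constructor
  · rintro (⟨t, ht, h⟩ | ⟨s, hs, h⟩)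
    · exact .inl ⟨t, ht, Subtype.ext h.symm⟩
    · exact .inr ⟨s, hs, Subtype.ext h.symm⟩
  · rintro (⟨t, ht, rfl⟩ | ⟨s, hs, rfl⟩)
    · exact mapsTo_cursor S T ht
    · exact mapsTo_lamp S T hs

theorem finite_setOf_left_ne (u v : WreathProduct G H) :
    {z | u.1.left z ≠ v.1.left z}.Finite := by
  refine (u.2.union v.2).subset fun z hz => ?_
  by_contra h
  simp only [Set.mem_union, not_or] at h
  obtain ⟨h1, h2⟩ := h
  exact hz ((Function.notMem_mulSupport.1 h1).trans (Function.notMem_mulSupport.1 h2).symm)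

instance [Countable G] [Countable H] :
    Countable {f : H → G // (Function.mulSupport f).Finite} := by
  refine Function.Injective.countable (β := Finset (H × G))
    (f := fun f => (f.2.image fun z => (z, f.1 z)).toFinset) fun f g hfg => Subtype.ext ?_
  have key : ∀ z y, (f.1 z ≠ 1 ∧ f.1 z = y) ↔ (g.1 z ≠ 1 ∧ g.1 z = y) := fun z y => by
    have := congrArg ((z, y) ∈ ·) hfg
    simpa [and_assoc] using this
  ext z
  by_cases h : f.1 z = 1
  · by_contra hne
    exact ((key z (g.1 z)).2 ⟨fun h' => hne (h.trans h'.symm), rfl⟩).1 h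
  · exact ((key z (f.1 z)).1 ⟨h, rfl⟩).2.symm

theorem countable [Countable G] [Countable H] : Countable (WreathProduct G H) := by
  refine Function.Injective.countable
    (β := {f : H → G // (Function.mulSupport f).Finite} × H)
    (f := fun w => (⟨w.1.left, w.2⟩, w.1.right)) fun u v h => ?_
  rw [Prod.mk.injEq] at h
  exact Subtype.ext (RegularWreathProduct.ext (congrArg Subtype.val h.1) h.2)

end WreathProduct

/-- The successive distances along the path that starts at `a`, visits the points of the list and
ends at `b`. -/
def pathSteps {X : Type*} (d : X → X → ℕ) : X → List X → X → List ℕ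
  | a, [], b => [d a b]
  | a, z :: l, b => d a z :: pathSteps d z l b

theorem length_pathSteps {X : Type*} (d : X → X → ℕ) (a : X) (l : List X) (b : X) :
    (pathSteps d a l b).length = l.length + 1 := by
  induction l generalizing a with
  | nil => rfl
  | cons z l ih => simp [pathSteps, ih]

theorem exists_of_mem_pathSteps {X : Type*} {d : X → X → ℕ} {a b : X} {l : List X} {k : ℕ}
    (hk : k ∈ pathSteps d a l b) :
    ∃ x ∈ a :: b :: l, ∃ y ∈ a :: b :: l, k = d x y := by
  induction l generalizing a with
  | nil =>
    obtain rfl : k = d a b := by simpa [pathSteps] using hk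
    exact ⟨a, by simp, b, by simp, rfl⟩
  | cons z l ih =>
    rcases List.mem_cons.1 hk with rfl | hk
    · exact ⟨a, by simp, z, by simp, rfl⟩
    · obtain ⟨x, hx, y, hy, rfl⟩ := ih hk
      refine ⟨x, ?_, y, ?_, rfl⟩ <;> simp only [List.mem_cons] at * <;> tauto

namespace WreathProduct

variable {G H : Type*} [Group G] [Group H] {S : Set G} {T : Set H}

/-- To get from `u` to `v`, walk the cursor along any path that visits all points where the lamps
differ, and change the lamps on the way. -/
theorem isWordOfLengthLE_of_path (hS : Subgroup.closure S = ⊤) (hT : Subgroup.closure T = ⊤)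
    (l : List H) (u v : WreathProduct G H) (h : ∀ z, u.1.left z ≠ v.1.left z → z ∈ l) :
    IsWordOfLengthLE (wreathGenerators S T) (u⁻¹ * v)
      ((pathSteps (wordDist T) u.1.right l v.1.right).sum +
        (l.map fun z => wordDist S (u.1.left z) (v.1.left z)).sum) := by
  classical
  induction l generalizing u with
  | nil =>
    have hv : v = u * cursor (u.1.right⁻¹ * v.1.right) := by
      ext z
      · rw [left_mul_cursor]
        by_contra hne
        simpa using h z (Ne.symm hne)
      · rw [right_mul_cursor, mul_inv_cancel_left]
    have hw := (isWordOfLengthLE_wordLength hT (u.1.right⁻¹ * v.1.right)).map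
      (cursor (G := G)) (mapsTo_cursor S T)
    have : u⁻¹ * v = cursor (u.1.right⁻¹ * v.1.right) := by
      rw [inv_mul_eq_iff_eq_mul]; exact hv
    rw [this]
    exact hw.mono (by simp [pathSteps, wordDist])
  | cons z l ih =>
    set a : WreathProduct G H := cursor (u.1.right⁻¹ * z) with ha
    set b : WreathProduct G H := lamp ((u.1.left z)⁻¹ * v.1.left z) with hb
    have hr : (u * a * b).1.right = z := by
      rw [hb, right_mul_lamp, ha, right_mul_cursor, mul_inv_cancel_left]
    have hr' : (u * a).1.right = z := by rw [ha, right_mul_cursor, mul_inv_cancel_left]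
    have hl : (u * a * b).1.left = Function.update u.1.left z (v.1.left z) := by
      rw [hb, left_mul_lamp, hr', ha, left_mul_cursor, mul_inv_cancel_left]
    have hstep := ih (u * a * b) fun y hy => by
      have hyz : y ≠ z := by
        rintro rfl
        rw [hl, Function.update_self] at hy
        exact hy rfl
      rw [hl, Function.update_of_ne hyz] at hy
      exact (List.mem_cons.1 (h y hy)).resolve_left hyz
    have hwa := (isWordOfLengthLE_wordLength hT (u.1.right⁻¹ * z)).map
      (cursor (G := G)) (mapsTo_cursor S T)
    have hwb := (isWordOfLengthLE_wordLength hS ((u.1.left z)⁻¹ * v.1.left z)).map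
      (lamp (H := H)) (mapsTo_lamp S T)
    have heq : u⁻¹ * v = a * b * ((u * a * b)⁻¹ * v) := by group
    rw [heq]
    refine ((hwa.mul hwb).mul hstep).mono ?_
    rw [hr]
    have hle : (l.map fun y => wordDist S ((u * a * b).1.left y) (v.1.left y)).sum ≤
        (l.map fun y => wordDist S (u.1.left y) (v.1.left y)).sum := by
      refine List.sum_le_sum fun y _ => ?_
      by_cases hyz : y = z
      · subst hyz
        rw [hl, Function.update_self, wordDist_self]
        exact Nat.zero_le _
      · rw [hl, Function.update_of_ne hyz]
    simp only [pathSteps, List.sum_cons, List.map_cons]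
    simp only [wordDist] at hle ⊢
    omega

end WreathProduct

/-! ### Cut kernels -/

/-- `K` is a cut kernel: `K x y` is the measure of the symmetric difference of two
measurable subsets `A x`, `A y` of the measure space `ℕ × ([0,1] × ℝ)`, the first factor with the
counting measure. The sets are given by their slices `A x n`, `n : ℕ`. -/
def IsCutKernel {X : Type*} (K : X → X → ℝ≥0∞) : Prop :=
  ∃ A : X → ℕ → Set (unitInterval × ℝ), (∀ x n, MeasurableSet (A x n)) ∧
    ∀ x y, K x y = ∑' n, volume (symmDiff (A x n) (A y n))

namespace IsCutKernel

variable {X : Type*}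

theorem of_countable {ι : Type*} [Countable ι] (A : X → ι → Set (unitInterval × ℝ))
    (hA : ∀ x i, MeasurableSet (A x i)) :
    IsCutKernel fun x y => ∑' i, volume (symmDiff (A x i) (A y i)) := by
  obtain ⟨e, he⟩ := exists_injective_nat ι
  refine ⟨fun x n => ⋃ (i) (_ : e i = n), A x i,
    fun x n => MeasurableSet.iUnion fun i => MeasurableSet.iUnion fun _ => hA x i, fun x y => ?_⟩
  have hB : ∀ x i, (⋃ (j) (_ : e j = e i), A x j) = A x i := fun x i => by
    simp [he.eq_iff]
  rw [← he.tsum_eq]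
  · simp only [hB]
  · intro n hn
    by_contra h
    refine hn ?_
    have : ∀ x, (⋃ (j) (_ : e j = n), A x j) = ∅ := fun x => by
      simp only [Set.iUnion_eq_empty]
      exact fun i hi => absurd ⟨i, hi⟩ h
    simp only [this, symmDiff_self, Set.bot_eq_empty, measure_empty]

theorem single (A : X → Set (unitInterval × ℝ)) (hA : ∀ x, MeasurableSet (A x)) :
    IsCutKernel fun x y => volume (symmDiff (A x) (A y)) := by
  simpa using of_countable (ι := Unit) (fun x _ => A x) fun x _ => hA x

theorem tsum {ι : Type*} [Countable ι] {K : ι → X → X → ℝ≥0∞} (hK : ∀ i, IsCutKernel (K i)) :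
    IsCutKernel fun x y => ∑' i, K i x y := by
  choose A hA h using hK
  have := of_countable (ι := ι × ℕ) (fun x i => A i.1 x i.2) fun x i => hA _ _ _
  convert this using 3 with x y
  rw [ENNReal.tsum_prod (f := fun i n => volume (symmDiff (A i x n) (A i y n)))]
  exact tsum_congr fun i => h i x y

theorem add {K L : X → X → ℝ≥0∞} (hK : IsCutKernel K) (hL : IsCutKernel L) :
    IsCutKernel fun x y => K x y + L x y := by
  have := tsum (ι := Bool) (K := fun b => if b then K else L) (by rintro (_ | _) <;> simpa)
  simpa [tsum_bool, add_comm] using this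

theorem comap {Y : Type*} {K : X → X → ℝ≥0∞} (hK : IsCutKernel K) (π : Y → X) :
    IsCutKernel fun x y => K (π x) (π y) := by
  obtain ⟨A, hA, h⟩ := hK
  exact ⟨fun y => A (π y), fun y => hA _, fun x y => h _ _⟩

theorem self {K : X → X → ℝ≥0∞} (hK : IsCutKernel K) (x : X) : K x x = 0 := by
  obtain ⟨A, hA, h⟩ := hK
  simp [h]

theorem symm {K : X → X → ℝ≥0∞} (hK : IsCutKernel K) (x y : X) : K x y = K y x := by
  obtain ⟨A, hA, h⟩ := hK
  simp only [h, symmDiff_comm]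

theorem triangle {K : X → X → ℝ≥0∞} (hK : IsCutKernel K) (x y z : X) :
    K x z ≤ K x y + K y z := by
  obtain ⟨A, hA, h⟩ := hK
  simp only [h, ← ENNReal.tsum_add]
  exact ENNReal.tsum_le_tsum fun n =>
    (measure_mono (symmDiff_triangle (A x n) (A y n) (A z n))).trans (measure_union_le _ _)

end IsCutKernel

open scoped Classical in
/-- The kernel with the value `2` off the diagonal: the sum over all points of the cuts that
separate the point from the rest. -/
noncomputable def discreteKernel {X : Type*} (x y : X) : ℝ≥0∞ := if x = y then 0 else 2

theorem discreteKernel_le_two {X : Type*} (x y : X) : discreteKernel x y ≤ 2 := by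
  unfold discreteKernel; split_ifs <;> simp

theorem isCutKernel_discreteKernel {X : Type*} [Countable X] :
    IsCutKernel (discreteKernel (X := X)) := by
  classical
  let Q : Set (unitInterval × ℝ) := Set.univ ×ˢ Set.Icc 0 1
  have hQ : MeasurableSet Q := MeasurableSet.univ.prod measurableSet_Icc
  have hvol : volume Q = 1 := by
    rw [Measure.volume_eq_prod, Measure.prod_prod]
    simp
  have := IsCutKernel.of_countable (X := X) (ι := X) (fun x i => if x = i then Q else ∅)
    (fun x i => by split_ifs <;> simp [hQ])
  convert this using 3 with x y
  have key : ∀ i, volume (symmDiff (if x = i then Q else ∅) (if y = i then Q else ∅)) =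
      if x = y then 0 else (if i = x then 1 else 0) + if i = y then (1 : ℝ≥0∞) else 0 := by
    intro i
    by_cases hxy : x = y
    · simp [hxy]
    · rcases eq_or_ne i x with rfl | hx
      · simp [hxy, Ne.symm hxy, hvol, ← Set.bot_eq_empty]
      · rcases eq_or_ne i y with rfl | hy
        · simp [hxy, hx, hvol, ← Set.bot_eq_empty]
        · simp [hxy, hx, hy, hx.symm, hy.symm]
  simp only [key, discreteKernel]
  split_ifs
  · simp
  · rw [ENNReal.tsum_add, tsum_ite_eq, tsum_ite_eq, one_add_one_eq_two]

theorem volume_symmDiff_Iio (a b : ℝ) :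
    volume (symmDiff (Set.Iio a) (Set.Iio b)) = ‖a - b‖ₑ := by
  rw [Set.symmDiff_def, measure_union (Set.disjoint_left.2 (by simp +contextual))
    (by measurability)]
  have h : ∀ a b : ℝ, Set.Iio a \ Set.Iio b = Set.Ico b a := fun a b => by
    ext x; simp
  rw [h, h, Real.volume_Ico, Real.volume_Ico, Real.enorm_eq_ofReal_abs]
  rcases le_total a b with hab | hab
  · rw [ENNReal.ofReal_of_nonpos (sub_nonpos.2 hab), zero_add, abs_of_nonpos (sub_nonpos.2 hab),
      neg_sub]
  · rw [ENNReal.ofReal_of_nonpos (sub_nonpos.2 hab), add_zero, abs_of_nonneg (sub_nonneg.2 hab)]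

/-- An `L₁`-valued map is turned into cuts by taking the subgraphs of its values. -/
theorem isCutKernel_enorm_sub {X : Type*} (ψ : X → LpSpace 1) :
    IsCutKernel fun x y => ‖ψ x - ψ y‖ₑ := by
  have hm : ∀ x, Measurable (ψ x) := fun x => (Lp.stronglyMeasurable (ψ x)).measurable
  have hA : ∀ x, MeasurableSet {s : unitInterval × ℝ | s.2 < ψ x s.1} := fun x =>
    measurableSet_lt measurable_snd ((hm x).comp measurable_fst)
  convert IsCutKernel.single (fun x => {s : unitInterval × ℝ | s.2 < ψ x s.1}) hA with x y
  rw [Measure.volume_eq_prod, Measure.prod_apply ((hA x).symmDiff (hA y)), Lp.enorm_def,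
    eLpNorm_congr_ae (Lp.coeFn_sub _ _), eLpNorm_one_eq_lintegral_enorm]
  exact lintegral_congr fun ω => (volume_symmDiff_Iio (ψ x ω) (ψ y ω)).symm

/-! ### Embedding cut kernels into `L_p([0,1])` -/

/-- Every nonzero `σ`-finite measure on a standard Borel space is the image of a measure on `[0,1]` with a
finite density with respect to Lebesgue measure. -/
theorem exists_map_withDensity_unitInterval {Ω : Type*} [MeasurableSpace Ω] [StandardBorelSpace Ω]
    (μ : Measure Ω) [SigmaFinite μ] [NeZero μ] :
    ∃ (g : unitInterval → Ω) (h : unitInterval → ℝ≥0), Measurable g ∧ Measurable h ∧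
      ∀ B : Set Ω, MeasurableSet B → μ B = ∫⁻ t in g ⁻¹' B, h t := by
  have : Nonempty Ω := by
    by_contra hne
    rw [not_nonempty_iff] at hne
    exact NeZero.ne μ μ.eq_zero_of_isEmpty
  obtain ⟨g, hg, hgμ⟩ := Measure.exists_measurable_map_eq μ.toFinite
  have hr : Measurable (μ.rnDeriv μ.toFinite) := Measure.measurable_rnDeriv _ _
  refine ⟨g, fun t => (μ.rnDeriv μ.toFinite (g t)).toNNReal, hg, (hr.comp hg).ennreal_toNNReal,
    fun B hB => ?_⟩
  have hac := absolutelyContinuous_toFinite μ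
  conv_lhs => rw [← Measure.withDensity_rnDeriv_eq μ μ.toFinite hac]
  rw [withDensity_apply _ hB]
  have : ∫⁻ s in B, μ.rnDeriv μ.toFinite s ∂μ.toFinite =
      ∫⁻ s in B, ((μ.rnDeriv μ.toFinite s).toNNReal : ℝ≥0∞) ∂μ.toFinite := by
    refine lintegral_congr_ae (ae_restrict_of_ae ?_)
    filter_upwards [Measure.rnDeriv_lt_top μ μ.toFinite] with s hs
    exact (ENNReal.coe_toNNReal hs.ne).symm
  rw [this]
  conv_lhs => rw [← hgμ]
  rw [setLIntegral_map hB (by fun_prop) hg, hgμ]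

/-- A finite cut kernel is the `q`-th power of the distance in `L_q`: the difference of two
indicator functions takes only the values `0` and `±1`. -/
theorem IsCutKernel.exists_map_Lp {X : Type*} {K : X → X → ℝ≥0∞} (hK : IsCutKernel K)
    (hfin : ∀ x y, K x y ≠ ∞) (q : ℝ≥0∞) [Fact (1 ≤ q)] (hq : q ≠ ∞) :
    ∃ Φ : X → LpSpace q, ∀ x y, ‖Φ x - Φ y‖ₑ = K x y ^ (1 / q.toReal) := by
  rcases isEmpty_or_nonempty X with hX | ⟨⟨x₀⟩⟩
  · exact ⟨fun _ => 0, fun x => isEmptyElim x⟩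
  obtain ⟨A, hA, hAK⟩ := hK
  have hq0 : q ≠ 0 := (zero_lt_one.trans_le Fact.out).ne'
  have hqpos : 0 < q.toReal := ENNReal.toReal_pos hq0 hq
  let μ : Measure (ℕ × (unitInterval × ℝ)) := Measure.count.prod volume
  have : NeZero μ := ⟨fun h => by
    have h1 : μ (Set.univ ×ˢ Set.univ) = 0 := by rw [h]; rfl
    rw [Measure.prod_prod] at h1
    have h2 : (volume : Measure (unitInterval × ℝ)) (Set.univ ×ˢ Set.univ) = 0 := by
      simpa using h1
    rw [Measure.volume_eq_prod, Measure.prod_prod] at h2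
    simp at h2⟩
  obtain ⟨g, h, hg, hh, hμ⟩ := exists_map_withDensity_unitInterval μ
  let B : X → Set (ℕ × (unitInterval × ℝ)) := fun x => {s | s.2 ∈ A x s.1}
  have hB : ∀ x, MeasurableSet (B x) := fun x => by
    have : B x = ⋃ n, {n} ×ˢ A x n := by ext ⟨n, s⟩; simp [B]
    rw [this]
    exact .iUnion fun n => (measurableSet_singleton n).prod (hA x n)
  have hμB : ∀ x y, μ (symmDiff (B x) (B y)) = K x y := fun x y => by
    rw [Measure.prod_apply ((hB x).symmDiff (hB y)), lintegral_count, hAK]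
    rfl
  -- The density enters with the exponent `1 / q`.
  let F : X → unitInterval → ℝ := fun x =>
    (g ⁻¹' B x).indicator fun t => (h t : ℝ) ^ (1 / q.toReal)
  have hF : ∀ x, Measurable (F x) := fun x =>
    Measurable.indicator (by fun_prop) (hg (hB x))
  have hnorm : ∀ x y, eLpNorm (F x - F y) q volume = K x y ^ (1 / q.toReal) := fun x y => by
    rw [eLpNorm_eq_lintegral_rpow_enorm_toReal hq0 hq, ← hμB,
      hμ _ ((hB x).symmDiff (hB y)), ← lintegral_indicator (hg ((hB x).symmDiff (hB y)))]
    congr 1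
    refine lintegral_congr fun t => ?_
    have hpow : ‖(h t : ℝ) ^ (1 / q.toReal)‖ₑ ^ q.toReal = h t := by
      rw [← NNReal.coe_rpow, NNReal.enorm_eq, ← ENNReal.coe_rpow_of_nonneg _ hqpos.le,
        ← NNReal.rpow_mul, one_div_mul_cancel hqpos.ne', NNReal.rpow_one]
    by_cases hx : g t ∈ B x <;> by_cases hy : g t ∈ B y <;>
      simp [F, hx, hy, Set.mem_symmDiff, hqpos] <;> simpa using hpow
  have hmem : ∀ x, MemLp (F x - F x₀) q volume := fun x =>
    ⟨((hF x).sub (hF x₀)).aestronglyMeasurable, by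
      rw [hnorm]
      exact ENNReal.rpow_lt_top_of_nonneg (by positivity) (hfin _ _)⟩
  refine ⟨fun x => (hmem x).toLp _, fun x y => ?_⟩
  rw [← MemLp.toLp_sub, Lp.enorm_toLp, sub_sub_sub_cancel_right, hnorm]

/-! ### Gaussian embedding of `L₂` into `L_p` -/

open ProbabilityTheory in
/-- A linear combination of independent standard Gaussian variables is a centred Gaussian variable,
so its `L_p` norm is proportional to the `ℓ₂` norm of the coefficients. -/
theorem eLpNorm_sum_gaussian {ι : Type*} (s : Finset ι) (a : ι → ℝ) (p : ℝ≥0∞) :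
    eLpNorm (fun ω : ι → ℝ => ∑ i ∈ s, a i * ω i) p
        (Measure.infinitePi fun _ => gaussianReal 0 1) =
      ‖Real.sqrt (∑ i ∈ s, a i ^ 2)‖ₑ * eLpNorm id p (gaussianReal 0 1) := by
  classical
  set P := Measure.infinitePi fun _ : ι => gaussianReal 0 1 with hP
  have hind : iIndepFun (fun i (ω : ι → ℝ) => a i * ω i) P :=
    iIndepFun_infinitePi (P := fun _ : ι => gaussianReal 0 1) (X := fun i x => a i * x)
      fun i => by fun_prop
  have hlaw : ∀ i, P.map (fun ω => a i * ω i) = gaussianReal 0 (‖a i‖₊ ^ 2) := fun i => by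
    have h1 : P.map (fun ω => ω i) = gaussianReal 0 1 :=
      Measure.infinitePi_map_eval (fun _ : ι => gaussianReal 0 1) i
    have h2 := gaussianReal_map_const_mul (μ := 0) (v := 1) (a i)
    rw [← h1, Measure.map_map (by fun_prop) (by fun_prop)] at h2
    refine h2.trans ?_
    congr 1
    · simp
    · ext; simp
  have hsum : P.map (fun ω => ∑ i ∈ s, a i * ω i) = gaussianReal 0 (∑ i ∈ s, ‖a i‖₊ ^ 2) := by
    induction s using Finset.induction_on with
    | empty =>
      simp [gaussianReal_zero_var, Measure.map_const]
    | insert i s hi ih =>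
      have hindep := (hind.indepFun_finsetSum_of_notMem (fun i => by fun_prop) hi).symm
      have := gaussianReal_add_gaussianReal_of_indepFun hindep (hlaw i)
        (by simpa [Finset.sum_fn] using ih)
      rw [Finset.sum_insert hi]
      convert this using 2
      · ext ω
        simp [Finset.sum_insert hi]
      · simp
  have hscale : gaussianReal 0 (∑ i ∈ s, ‖a i‖₊ ^ 2) =
      (gaussianReal 0 1).map (Real.sqrt (∑ i ∈ s, a i ^ 2) * ·) := by
    rw [gaussianReal_map_const_mul]
    congr 1
    · simp
    · ext
      simp [Real.sq_sqrt (Finset.sum_nonneg fun i _ => sq_nonneg (a i))]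
  have h3 := eLpNorm_map_measure (μ := P) (p := p) (f := fun ω => ∑ i ∈ s, a i * ω i)
    (g := (id : ℝ → ℝ)) (by fun_prop) (Measurable.aemeasurable (by fun_prop))
  rw [Function.id_comp] at h3
  rw [← h3, hsum, hscale, eLpNorm_map_measure (by fun_prop) (by fun_prop)]
  exact eLpNorm_const_smul (Real.sqrt (∑ i ∈ s, a i ^ 2)) (id : ℝ → ℝ) p _

open ProbabilityTheory in
/-- The product space of a countable Gaussian family is standard Borel, so the family can be realised
on `[0,1]`. -/
theorem exists_gaussian_family (ι : Type*) [Countable ι] (p : ℝ≥0∞) [Fact (1 ≤ p)] (hp : p ≠ ∞) :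
    ∃ (Z : ι → LpSpace p) (m : ℝ), 0 < m ∧ ∀ (s : Finset ι) (a : ι → ℝ),
      ‖∑ i ∈ s, a i • Z i‖ = m * Real.sqrt (∑ i ∈ s, a i ^ 2) := by
  have hp0 : p ≠ 0 := (zero_lt_one.trans_le Fact.out).ne'
  set P := Measure.infinitePi fun _ : ι => gaussianReal 0 1 with hP
  obtain ⟨g, hg, hgP⟩ := Measure.exists_measurable_map_eq P
  have hid : MemLp id p (gaussianReal 0 1) := memLp_id_gaussianReal' p hp
  have hsum : ∀ (s : Finset ι) (a : ι → ℝ),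
      eLpNorm (fun t => ∑ i ∈ s, a i * g t i) p volume =
        ‖Real.sqrt (∑ i ∈ s, a i ^ 2)‖ₑ * eLpNorm id p (gaussianReal 0 1) := fun s a => by
    rw [← eLpNorm_sum_gaussian, ← hP, ← hgP,
      eLpNorm_map_measure (Measurable.aestronglyMeasurable (by fun_prop)) (by fun_prop)]
    rfl
  have hmem : ∀ i, MemLp (fun t => g t i) p volume := fun i => by
    refine ⟨by fun_prop, ?_⟩
    have := hsum {i} 1
    simp only [Finset.sum_singleton, Pi.one_apply, one_mul, one_pow, Real.sqrt_one, enorm_one]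
      at this
    rw [this]
    exact hid.2
  refine ⟨fun i => (hmem i).toLp _, (eLpNorm id p (gaussianReal 0 1)).toReal, ?_, fun s a => ?_⟩
  · refine ENNReal.toReal_pos (fun h => ?_) hid.2.ne
    rw [eLpNorm_eq_zero_iff (by fun_prop) hp0] at h
    have h1 : ∀ᵐ x ∂gaussianReal 0 1, x = 0 := h
    have := nullSingletonClass_gaussianReal (μ := 0) (v := 1) one_ne_zero
    have h2 : ∀ᵐ x ∂gaussianReal 0 1, x ≠ 0 := by simp [ae_iff]
    obtain ⟨x, hx, hx'⟩ := (h1.and h2).exists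
    exact hx' hx
  · have hae : (∑ i ∈ s, a i • (hmem i).toLp _ : LpSpace p) =ᵐ[volume]
        fun t => ∑ i ∈ s, a i * g t i := by
      have h1 : ∀ i ∈ s, ∀ᵐ t, (a i • (hmem i).toLp _ : LpSpace p) t = a i * g t i := fun i _ => by
        filter_upwards [Lp.coeFn_smul (a i) ((hmem i).toLp _), (hmem i).coeFn_toLp] with t h1 h2
        rw [h1, Pi.smul_apply, h2, smul_eq_mul]
      have h2 := (Finset.eventually_all s).2 h1
      filter_upwards [h2, Lp.coeFn_finsetSum s fun i => a i • (hmem i).toLp _] with t h2 h3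
      rw [h3, Finset.sum_apply]
      exact Finset.sum_congr rfl h2
    rw [Lp.norm_def, eLpNorm_congr_ae hae, hsum, ENNReal.toReal_mul, mul_comm]
    simp

theorem exists_hasSum_smul_of_norm_sum_eq {ι E : Type*} [NormedAddCommGroup E] [NormedSpace ℝ E]
    [CompleteSpace E] {Z : ι → E} {m : ℝ}
    (hZ : ∀ (s : Finset ι) (a : ι → ℝ), ‖∑ i ∈ s, a i • Z i‖ = m * Real.sqrt (∑ i ∈ s, a i ^ 2))
    (hm : 0 < m) {a : ι → ℝ} {σ : ℝ} (ha : HasSum (fun i => a i ^ 2) σ) :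
    ∃ v, HasSum (fun i => a i • Z i) v ∧ ‖v‖ = m * Real.sqrt σ := by
  have hsum : Summable fun i => a i • Z i := by
    rw [summable_iff_vanishing_norm]
    intro ε hε
    obtain ⟨s, hs⟩ := summable_iff_vanishing_norm.1 ha.summable ((ε / m) ^ 2) (by positivity)
    refine ⟨s, fun t ht => ?_⟩
    have h1 := (Real.le_norm_self _).trans_lt (hs t ht)
    rw [hZ, mul_comm, ← lt_div_iff₀ hm]
    exact (Real.sqrt_lt' (by positivity)).2 h1
  obtain ⟨v, hv⟩ := hsum
  refine ⟨v, hv, tendsto_nhds_unique hv.norm ?_⟩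
  simp only [hZ]
  exact ((Real.continuous_sqrt.tendsto _).comp ha).const_mul m

theorem Orthonormal.countable_of_secondCountableTopology {ι E : Type*} [NormedAddCommGroup E]
    [InnerProductSpace ℝ E] [SecondCountableTopology E] {b : ι → E} (hb : Orthonormal ℝ b) :
    Countable ι := by
  have hd : ∀ i j, i ≠ j → 1 ≤ dist (b i) (b j) := fun i j hij => by
    have h1 : ‖b i - b j‖ ^ 2 = 2 := by
      rw [norm_sub_sq_real, hb.2 hij, hb.1, hb.1]; norm_num
    rw [dist_eq_norm]
    nlinarith [norm_nonneg (b i - b j)]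
  have hdisj : Pairwise (Function.onFun Disjoint fun i => Metric.ball (b i) (1 / 2)) :=
    fun i j hij => Metric.ball_disjoint_ball (by linarith [hd i j hij])
  exact Pairwise.countable_of_isOpen_disjoint hdisj (fun i => Metric.isOpen_ball)
    fun i => ⟨b i, by simp⟩

/-- Up to a positive factor, `L₂` embeds isometrically into `L_p`. -/
theorem exists_map_L2_Lp (p : ℝ≥0∞) [Fact (1 ≤ p)] (hp : p ≠ ∞) :
    ∃ (J : LpSpace 2 → LpSpace p) (m : ℝ), 0 < m ∧ ∀ f g, ‖J f - J g‖ = m * ‖f - g‖ := by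
  have : Fact ((2 : ℝ≥0∞) ≠ ∞) := ⟨by simp⟩
  obtain ⟨w, b, -⟩ := exists_hilbertBasis ℝ (LpSpace 2)
  have : Countable w := b.orthonormal.countable_of_secondCountableTopology
  obtain ⟨Z, m, hm, hZ⟩ := exists_gaussian_family w p hp
  have hsq : ∀ f : LpSpace 2, HasSum (fun i => inner ℝ (b i) f ^ 2) (‖f‖ ^ 2) := fun f => by
    have h := b.hasSum_inner_mul_inner f f
    rw [real_inner_self_eq_norm_sq] at h
    simpa [pow_two, real_inner_comm] using h
  choose J hJ hJn using fun f => exists_hasSum_smul_of_norm_sum_eq hZ hm (hsq f)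
  have hadd : ∀ f g, J f - J g = J (f - g) := fun f g => by
    refine ((hJ f).sub (hJ g)).unique ?_
    simpa only [inner_sub_right, sub_smul] using hJ (f - g)
  refine ⟨J, m, hm, fun f g => ?_⟩
  rw [hadd, hJn, Real.sqrt_sq (norm_nonneg _)]

/-! ### Lifting cuts to the wreath product -/

namespace WreathProduct

variable {G H : Type*} [Group G] [Group H]

open scoped Classical in
/-- For each point `s`, the set `{h | s ∈ A h}` is one side of a cut of `H`. The wreath product
element `u` belongs to the lifted cut with label `f` if the cursor of `u` lies in that side and the
lamps of `u` agree with `f` off that side, where `f` is trivial on that side. -/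
def liftCut {Ω : Type*} (A : H → Set Ω) (f : H → G) (u : WreathProduct G H) : Set Ω :=
  {s | s ∈ A u.1.right ∧ ∀ z, (if s ∈ A z then 1 else u.1.left z) = f z}

theorem measurableSet_liftCut {Ω : Type*} [MeasurableSpace Ω] [Countable H] {A : H → Set Ω}
    (hA : ∀ h, MeasurableSet (A h)) (f : H → G) (u : WreathProduct G H) :
    MeasurableSet (liftCut A f u) := by
  classical
  have : liftCut A f u = A u.1.right ∩
      ⋂ z, Set.ite (A z) {_s | 1 = f z} {_s | u.1.left z = f z} := by
    ext s
    simp only [liftCut, Set.mem_inter_iff, Set.mem_iInter, Set.mem_ofPred_eq]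
    refine and_congr_right fun _ => forall_congr' fun z => ?_
    by_cases h : s ∈ A z <;> simp [Set.ite, h]
  rw [this]
  exact (hA _).inter (.iInter fun z => (hA z).ite (.const _) (.const _))

theorem exists_mem_liftCut {Ω : Type*} {A : H → Set Ω} {s : Ω} {u : WreathProduct G H}
    (hs : s ∈ A u.1.right) :
    ∃ f : {f : H → G // (Function.mulSupport f).Finite}, s ∈ liftCut A f.1 u := by
  classical
  refine ⟨⟨fun z => if s ∈ A z then 1 else u.1.left z, u.2.subset fun z hz => ?_⟩, hs, fun z => rfl⟩
  rw [Function.mem_mulSupport] at hz ⊢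
  intro h
  exact hz (by simp [h])

/-- The points where two elements of the wreath product are active: the two cursors and the lamps in
different states. -/
def activeSet (u v : WreathProduct G H) : Set H :=
  {a | a = u.1.right ∨ a = v.1.right ∨ u.1.left a ≠ v.1.left a}

/-- A cut of `H` that separates two active points of `u`, `v` lifts to a cut that separates `u` and
`v`, at least after exchanging the two sides. -/
theorem symmDiff_subset_iUnion_liftCut {Ω : Type*} (A : H → Set Ω) {u v : WreathProduct G H}
    {a b : H} (ha : a ∈ activeSet u v) (hb : b ∈ activeSet u v) :
    symmDiff (A a) (A b) ⊆
      (⋃ f : {f : H → G // (Function.mulSupport f).Finite},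
        symmDiff (liftCut A f.1 u) (liftCut A f.1 v)) ∪
      ⋃ f : {f : H → G // (Function.mulSupport f).Finite},
        symmDiff (liftCut (fun h => (A h)ᶜ) f.1 u) (liftCut (fun h => (A h)ᶜ) f.1 v) := by
  classical
  -- Cursors on the side `B`, and lamps in different states at a point off `B`.
  have key : ∀ (B : H → Set Ω) (s : Ω) (c : H), s ∈ B u.1.right → s ∉ B c →
      c ∈ activeSet u v → s ∈ B v.1.right →
      ∃ f : {f : H → G // (Function.mulSupport f).Finite},
        s ∈ symmDiff (liftCut B f.1 u) (liftCut B f.1 v) := by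
    rintro B s c hu hc (rfl | rfl | hne) hv
    · exact absurd hu hc
    · exact absurd hv hc
    · obtain ⟨f, hf⟩ := exists_mem_liftCut hu
      refine ⟨f, .inl ⟨hf, fun hf' => hne ?_⟩⟩
      have h1 := hf.2 c
      have h2 := hf'.2 c
      rw [if_neg hc] at h1 h2
      rw [h1, h2]
  intro s hs
  have hsep : (s ∈ A a ∧ s ∉ A b) ∨ (s ∈ A b ∧ s ∉ A a) := hs
  simp only [Set.mem_union, Set.mem_iUnion]
  by_cases hu : s ∈ A u.1.right <;> by_cases hv : s ∈ A v.1.right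
  · left
    rcases hsep with ⟨-, h⟩ | ⟨-, h⟩
    · exact key A s b hu h hb hv
    · exact key A s a hu h ha hv
  · obtain ⟨f, hf⟩ := exists_mem_liftCut hu
    exact .inl ⟨f, .inl ⟨hf, fun hf' => hv hf'.1⟩⟩
  · obtain ⟨f, hf⟩ := exists_mem_liftCut hv
    exact .inl ⟨f, .inr ⟨hf, fun hf' => hu hf'.1⟩⟩
  · right
    rcases hsep with ⟨h, -⟩ | ⟨h, -⟩
    · exact key (fun h => (A h)ᶜ) s a hu (not_not.2 h) ha hv
    · exact key (fun h => (A h)ᶜ) s b hu (not_not.2 h) hb hv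

/-- Moving the cursor from `x` to `y` crosses at most one lifted cut for each cut that separates `x`
from `y`. -/
theorem tsum_volume_liftCut_cursor_le {Ω : Type*} [MeasureSpace Ω] [Countable G] [Countable H]
    {A : H → Set Ω} (hA : ∀ h, MeasurableSet (A h)) (u : WreathProduct G H) (t : H) :
    ∑' f : {f : H → G // (Function.mulSupport f).Finite},
      volume (symmDiff (liftCut A f.1 u) (liftCut A f.1 (u * cursor t))) ≤
    volume (symmDiff (A u.1.right) (A (u.1.right * t))) := by
  rw [← measure_iUnion]
  · refine measure_mono (Set.iUnion_subset fun f s hs => ?_)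
    rcases hs with ⟨⟨h1, h2⟩, h3⟩ | ⟨⟨h1, h2⟩, h3⟩
    · refine .inl ⟨h1, fun h => h3 ⟨h, ?_⟩⟩
      rwa [left_mul_cursor]
    · refine .inr ⟨h1, fun h => h3 ⟨h, ?_⟩⟩
      rwa [left_mul_cursor] at h2
  · intro f g hfg
    refine Set.disjoint_left.2 fun s hf hg => hfg (Subtype.ext (funext fun z => ?_))
    have key : ∀ f : {f : H → G // (Function.mulSupport f).Finite},
        s ∈ symmDiff (liftCut A f.1 u) (liftCut A f.1 (u * cursor t)) →
        (open scoped Classical in if s ∈ A z then 1 else u.1.left z) = f.1 z := by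
      rintro f (⟨⟨-, h⟩, -⟩ | ⟨⟨-, h⟩, -⟩)
      · exact h z
      · rw [← h z, left_mul_cursor]
    exact (key f hf).symm.trans (key g hg)
  · exact fun f => (measurableSet_liftCut hA f.1 u).symmDiff (measurableSet_liftCut hA f.1 _)

/-- Changing the lamp at the cursor crosses no lifted cut. -/
theorem liftCut_lamp {Ω : Type*} (A : H → Set Ω) (f : H → G) (u : WreathProduct G H) (s : G) :
    liftCut A f (u * lamp s) = liftCut A f u := by
  classical
  ext ω
  simp only [liftCut, right_mul_lamp, left_mul_lamp, Set.mem_ofPred_eq]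
  refine and_congr_right fun h => forall_congr' fun z => ?_
  by_cases hz : z = u.1.right
  · subst hz; simp [h]
  · rw [Function.update_of_ne hz]

theorem exists_liftKernel [Countable G] [Countable H] {K : H → H → ℝ≥0∞} (hK : IsCutKernel K) :
    ∃ M : WreathProduct G H → WreathProduct G H → ℝ≥0∞, IsCutKernel M ∧
      (∀ u v, ∀ a ∈ activeSet u v, ∀ b ∈ activeSet u v, K a b ≤ M u v) ∧
      (∀ u t, M u (u * cursor t) ≤ 2 * K u.1.right (u.1.right * t)) ∧
      ∀ u s, M u (u * lamp s) = 0 := by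
  obtain ⟨A, hA, hAK⟩ := hK
  let D : (H → Set (unitInterval × ℝ)) → WreathProduct G H → WreathProduct G H → ℝ≥0∞ :=
    fun B u v => ∑' f : {f : H → G // (Function.mulSupport f).Finite},
      volume (symmDiff (liftCut B f.1 u) (liftCut B f.1 v))
  have hD : ∀ B : H → Set (unitInterval × ℝ), (∀ h, MeasurableSet (B h)) → IsCutKernel (D B) :=
    fun B hB => IsCutKernel.of_countable
      (ι := {f : H → G // (Function.mulSupport f).Finite}) (fun u f => liftCut B f.1 u)
      fun u f => measurableSet_liftCut hB _ _
  refine ⟨fun u v => ∑' n, (D (fun h => A h n) u v + D (fun h => (A h n)ᶜ) u v), ?_, ?_, ?_, ?_⟩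
  · exact IsCutKernel.tsum fun n =>
      (hD _ fun h => hA h n).add (hD _ fun h => (hA h n).compl)
  · intro u v a ha b hb
    rw [hAK]
    refine ENNReal.tsum_le_tsum fun n => ?_
    refine (measure_mono (symmDiff_subset_iUnion_liftCut (fun h => A h n) ha hb)).trans ?_
    exact (measure_union_le _ _).trans (add_le_add (measure_iUnion_le _) (measure_iUnion_le _))
  · intro u t
    rw [hAK, ← ENNReal.tsum_mul_left]
    refine ENNReal.tsum_le_tsum fun n => ?_
    rw [two_mul]
    refine add_le_add (tsum_volume_liftCut_cursor_le (fun h => hA h n) u t) ?_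
    refine (tsum_volume_liftCut_cursor_le (fun h => (hA h n).compl) u t).trans_eq ?_
    rw [compl_symmDiff_compl]
  · intro u s
    simp [D, liftCut_lamp]

end WreathProduct

/-! ### The kernel on the wreath product -/

/-- A kernel that obeys the triangle inequality and is bounded by `B` on generators grows at most
linearly in the word metric. -/
theorem IsCutKernel.le_mul_wordDist {Γ : Type*} [Group Γ] {S : Set Γ}
    (hS : ∀ g, ∃ n, IsWordOfLengthLE S g n) {K : Γ → Γ → ℝ≥0∞} (hK : IsCutKernel K) {B : ℝ≥0∞}
    (hB : ∀ u, ∀ a ∈ S, K u (u * a) ≤ B) (u v : Γ) : K u v ≤ B * wordDist S u v := by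
  obtain ⟨n, hn⟩ := hS (u⁻¹ * v)
  obtain ⟨l, h1, h2, h3⟩ := hn.exists_wordLength
  have key : ∀ (l : List Γ), (∀ a ∈ l, a ∈ S ∨ a⁻¹ ∈ S) → ∀ u, K u (u * l.prod) ≤ B * l.length := by
    intro l hl
    induction l with
    | nil => intro u; simp [hK.self]
    | cons a l ih =>
      intro u
      have ha : K u (u * a) ≤ B := by
        rcases hl a (by simp) with ha | ha
        · exact hB u a ha
        · rw [hK.symm]
          simpa using hB (u * a) _ ha
      have := ih (fun b hb => hl b (List.mem_cons_of_mem _ hb)) (u * a)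
      calc K u (u * (a :: l).prod) = K u (u * a * l.prod) := by rw [List.prod_cons, mul_assoc]
        _ ≤ K u (u * a) + K (u * a) (u * a * l.prod) := hK.triangle _ _ _
        _ ≤ B + B * l.length := add_le_add ha this
        _ = B * (a :: l).length := by rw [List.length_cons]; push_cast; ring
  have := key l h1 u
  rwa [h2, h3, mul_inv_cancel_left] at this

namespace WreathProduct

variable {G H : Type*} [Group G] [Group H] {S : Set G} {T : Set H}

theorem exists_isWordOfLengthLE (hS : Subgroup.closure S = ⊤) (hT : Subgroup.closure T = ⊤)
    (w : WreathProduct G H) : ∃ n, IsWordOfLengthLE (wreathGenerators S T) w n := by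
  have := isWordOfLengthLE_of_path hS hT (finite_setOf_left_ne 1 w).toFinset.toList 1 w (by simp)
  exact ⟨_, by simpa using this⟩

/-- Take any path through the `n` points where the lamps differ. All its steps join active points,
hence cost at most `M`, so the `n + 1` steps cost at most `(n + 1) * M`, and
`√((n + 1) * M) ≤ M + n + 1`. No optimal path is needed, as `wreathPartitionMin` is monotone. -/
theorem wreathPartitionMin_wordDist_le (hS : Subgroup.closure S = ⊤) (hT : Subgroup.closure T = ⊤)
    {ρ τ : ℝ≥0 → ℝ≥0} (hρ : Monotone ρ) (hτ : Monotone τ) {u v : WreathProduct G H}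
    {M : ℝ≥0} (hM : ∀ a ∈ activeSet u v, ∀ b ∈ activeSet u v, ρ (wordDist T a b) ≤ M) :
    wreathPartitionMin ρ τ (wordDist (wreathGenerators S T) u v) ≤
      M + (finite_setOf_left_ne u v).toFinset.card + 1 +
        ∑ z ∈ (finite_setOf_left_ne u v).toFinset, τ (wordDist S (u.1.left z) (v.1.left z)) := by
  set F := (finite_setOf_left_ne u v).toFinset with hF
  set P := pathSteps (wordDist T) u.1.right F.toList v.1.right with hP
  have hle := (isWordOfLengthLE_of_path hS hT F.toList u v (by simp [hF])).wordLength_le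
  have hsteps : ∀ k ∈ P, ρ k ≤ M := by
    intro k hk
    obtain ⟨a, ha, b, hb, rfl⟩ := exists_of_mem_pathSteps hk
    have hact : ∀ c ∈ u.1.right :: v.1.right :: F.toList, c ∈ activeSet u v := by
      intro c hc
      simpa [hF, activeSet] using hc
    exact hM a (hact a ha) b (hact b hb)
  have hpm : partitionMin ρ P.sum ≤ (F.card + 1) * M := by
    refine (partitionMin_le ρ P).trans ?_
    have := List.sum_le_card_nsmul (P.map fun k : ℕ => ρ k) M fun x hx => by
      obtain ⟨k, hk, rfl⟩ := List.mem_map.1 hx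
      exact hsteps k hk
    simpa [hP, length_pathSteps] using this
  have hsqrt : NNReal.sqrt (partitionMin ρ P.sum) ≤ M + F.card + 1 := by
    rw [NNReal.sqrt_le_iff_le_sq]
    refine hpm.trans ?_
    rw [add_assoc, pow_two]
    exact mul_le_mul' le_add_self le_self_add
  refine (wreathPartitionMin_mono hρ hτ hle).trans ((wreathPartitionMin_le ρ τ _ _).trans ?_)
  rw [List.map_map]
  refine add_le_add hsqrt (le_of_eq ?_)
  exact Finset.sum_map_toList F fun z => τ (wordDist S (u.1.left z) (v.1.left z))

/-- The kernel sums the lift of `K`, the kernel `L` and the discrete kernel over all lamps, and the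
discrete kernel of the wreath product. The discrete kernel over all lamps counts the lamps in
different states, and the last summand absorbs the constant `1` in the estimate of the path. -/
theorem exists_cutKernel (hSfin : S.Finite) (hS : Subgroup.closure S = ⊤)
    (hTfin : T.Finite) (hT : Subgroup.closure T = ⊤)
    {ρ τ : ℝ≥0 → ℝ≥0} (hρ : Monotone ρ) (hτ : Monotone τ)
    {K : H → H → ℝ≥0∞} (hK : IsCutKernel K) {L : G → G → ℝ≥0∞} (hL : IsCutKernel L)
    {A B : ℝ≥0} (hKA : ∀ x, ∀ t ∈ T, K x (x * t) ≤ A) (hLB : ∀ x, ∀ s ∈ S, L x (x * s) ≤ B)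
    (hρK : ∀ x y, (ρ (wordDist T x y) : ℝ≥0∞) ≤ K x y)
    (hτL : ∀ x y, (τ (wordDist S x y) : ℝ≥0∞) ≤ L x y) :
    ∃ (N : WreathProduct G H → WreathProduct G H → ℝ≥0∞) (C : ℝ≥0), 0 < C ∧ IsCutKernel N ∧
      ∀ u v, (wreathPartitionMin ρ τ (wordDist (wreathGenerators S T) u v) : ℝ≥0∞) ≤ N u v ∧
        N u v ≤ C * wordDist (wreathGenerators S T) u v := by
  classical
  have := countable_of_closure_eq_top hSfin hS
  have := countable_of_closure_eq_top hTfin hT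
  have := WreathProduct.countable (G := G) (H := H)
  obtain ⟨M, hM, hKM, hMcursor, hMlamp⟩ := exists_liftKernel (G := G) hK
  let E : G → G → ℝ≥0∞ := fun x y => L x y + discreteKernel x y
  have hE : IsCutKernel E := hL.add isCutKernel_discreteKernel
  let N : WreathProduct G H → WreathProduct G H → ℝ≥0∞ := fun u v =>
    M u v + (∑' z, E (u.1.left z) (v.1.left z)) + discreteKernel u v
  have hN : IsCutKernel N :=
    (hM.add (IsCutKernel.tsum fun z => hE.comap fun u : WreathProduct G H => u.1.left z)).add
      isCutKernel_discreteKernel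
  have hgen : ∀ u, ∀ a ∈ wreathGenerators S T, N u (u * a) ≤ (2 * A + (B + 2) + 2 : ℝ≥0) := by
    intro u a ha
    push_cast
    refine add_le_add ?_ (discreteKernel_le_two _ _)
    rcases mem_wreathGenerators.1 ha with ⟨t, ht, rfl⟩ | ⟨s, hs, rfl⟩
    · rw [left_mul_cursor]
      simp only [hE.self, tsum_zero, add_zero]
      refine le_add_right ((hMcursor u t).trans ?_)
      gcongr
      exact hKA _ t ht
    · rw [hMlamp, left_mul_lamp, zero_add, tsum_eq_single u.1.right]
      · refine le_add_left ?_
        rw [Function.update_self]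
        exact add_le_add (hLB _ s hs) (discreteKernel_le_two _ _)
      · intro z hz
        rw [Function.update_of_ne hz, hE.self]
  refine ⟨N, 2 * A + (B + 2) + 2, by positivity, hN, fun u v => ⟨?_,
    hN.le_mul_wordDist (exists_isWordOfLengthLE hS hT) hgen u v⟩⟩
  rcases eq_or_ne u v with rfl | huv
  · rw [wordDist_self, wreathPartitionMin_zero]
    simp
  rcases eq_or_ne (M u v) ∞ with hMtop | hMtop
  · simp [N, hMtop]
  have hbound := wreathPartitionMin_wordDist_le hS hT hρ hτ (M := (M u v).toNNReal)
    fun a ha b hb => by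
      rw [← ENNReal.coe_le_coe, ENNReal.coe_toNNReal hMtop]
      exact (hρK a b).trans (hKM u v a ha b hb)
  set F := (finite_setOf_left_ne u v).toFinset with hF
  refine (ENNReal.coe_le_coe.2 hbound).trans ?_
  push_cast
  rw [ENNReal.coe_toNNReal hMtop]
  have hsum : (F.card : ℝ≥0∞) +
      ∑ z ∈ F, (τ (wordDist S (u.1.left z) (v.1.left z)) : ℝ≥0∞) ≤
      ∑' z, E (u.1.left z) (v.1.left z) := by
    rw [add_comm, Finset.card_eq_sum_ones, Nat.cast_sum, ← Finset.sum_add_distrib]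
    refine le_trans (Finset.sum_le_sum fun z hz => ?_) (ENNReal.sum_le_tsum F)
    have hne : u.1.left z ≠ v.1.left z := by simpa [hF] using hz
    refine add_le_add (hτL _ _) ?_
    simp [discreteKernel, hne]
  have hone : (1 : ℝ≥0∞) ≤ discreteKernel u v := by simp [discreteKernel, huv]
  calc _ = M u v + ((F.card : ℝ≥0∞) +
        ∑ z ∈ F, (τ (wordDist S (u.1.left z) (v.1.left z)) : ℝ≥0∞)) + 1 := by ring
    _ ≤ M u v + (∑' z, E (u.1.left z) (v.1.left z)) + discreteKernel u v := by gcongr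

end WreathProduct

/-- A cut kernel embeds into `L_p` with the exponent `max {1/2, 1/p}`: directly if `p ≤ 2`, and
through `L₂` if `p > 2`. -/
theorem IsCutKernel.exists_map_Lp_rpow_compressionExponent {X : Type*} {K : X → X → ℝ≥0∞}
    (hK : IsCutKernel K) (hfin : ∀ x y, K x y ≠ ∞) (p : ℝ≥0∞) [Fact (1 ≤ p)] (hp : p ≠ ∞) :
    ∃ (Φ : X → LpSpace p) (m : ℝ≥0), 0 < m ∧
      ∀ x y, ‖Φ x - Φ y‖₊ = m * (K x y).toNNReal ^ compressionExponent p := by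
  have hp1 : 1 ≤ p.toReal := by
    rw [← ENNReal.toReal_one]
    exact ENNReal.toReal_mono hp Fact.out
  have hnn : ∀ {q : ℝ≥0∞} [Fact (1 ≤ q)] (f : LpSpace q) (x y : X),
      ‖f‖ₑ = K x y ^ (1 / q.toReal) → ‖f‖₊ = (K x y).toNNReal ^ (1 / q.toReal) := by
    intro q _ f x y h
    rw [← ENNReal.toNNReal_rpow, ← h, enorm_eq_nnnorm, ENNReal.toNNReal_coe]
  rcases le_total p.toReal 2 with h2 | h2
  · obtain ⟨Φ, hΦ⟩ := hK.exists_map_Lp hfin p hp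
    refine ⟨Φ, 1, one_pos, fun x y => ?_⟩
    rw [hnn _ x y (hΦ x y), one_mul, compressionExponent,
      max_eq_right (one_div_le_one_div_of_le (by linarith) h2)]
  · obtain ⟨Φ, hΦ⟩ := hK.exists_map_Lp hfin 2 (by simp)
    obtain ⟨J, m, hm, hJ⟩ := exists_map_L2_Lp p hp
    refine ⟨fun x => J (Φ x), ⟨m, hm.le⟩, hm, fun x y => ?_⟩
    have h3 : ‖J (Φ x) - J (Φ y)‖₊ = ⟨m, hm.le⟩ * ‖Φ x - Φ y‖₊ := NNReal.eq (hJ _ _)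
    rw [h3, hnn _ x y (hΦ x y), compressionExponent,
      max_eq_left (one_div_le_one_div_of_le (by norm_num) h2)]
    simp

namespace WreathProduct

variable {G H : Type*} [Group G] [Group H] {S : Set G} {T : Set H}

/-- The embedding for arbitrary cut kernels `K` on `H` and `L` on `G` in place of the distances in
`L₁`, so that discrete kernels may be added to these. -/
theorem exists_embedding (hSfin : S.Finite) (hS : Subgroup.closure S = ⊤)
    (hTfin : T.Finite) (hT : Subgroup.closure T = ⊤) (p : ℝ≥0∞) [Fact (1 ≤ p)] (hp : p ≠ ∞)
    {ρ τ : ℝ≥0 → ℝ≥0} (hρ : Monotone ρ) (hτ : Monotone τ)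
    {K : H → H → ℝ≥0∞} (hK : IsCutKernel K) {L : G → G → ℝ≥0∞} (hL : IsCutKernel L)
    {A B : ℝ≥0} (hKA : ∀ x, ∀ t ∈ T, K x (x * t) ≤ A) (hLB : ∀ x, ∀ s ∈ S, L x (x * s) ≤ B)
    (hρK : ∀ x y, (ρ (wordDist T x y) : ℝ≥0∞) ≤ K x y)
    (hτL : ∀ x y, (τ (wordDist S x y) : ℝ≥0∞) ≤ L x y) :
    ∃ (Φ : WreathProduct G H → LpSpace p) (c C : ℝ≥0), 0 < c ∧ 0 < C ∧
      ∀ u v : WreathProduct G H,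
        c * lowerModulus p ρ τ (wordDist (wreathGenerators S T) u v) ≤ ‖Φ u - Φ v‖₊ ∧
        ‖Φ u - Φ v‖₊ ≤ C * upperModulus p (wordDist (wreathGenerators S T) u v) := by
  obtain ⟨N, C, hC, hN, hNbound⟩ :=
    exists_cutKernel hSfin hS hTfin hT hρ hτ hK hL hKA hLB hρK hτL
  have hfin : ∀ u v, N u v ≠ ∞ := fun u v =>
    ((hNbound u v).2.trans_lt (ENNReal.mul_lt_top ENNReal.coe_lt_top (by simp))).ne
  obtain ⟨Φ, m, hm, hΦ⟩ := hN.exists_map_Lp_rpow_compressionExponent hfin p hp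
  have hα := (compressionExponent_pos p).le
  refine ⟨Φ, m, m * C ^ compressionExponent p, hm, by positivity, fun u v => ?_⟩
  obtain ⟨h1, h2⟩ := hNbound u v
  rw [hΦ]
  constructor
  · refine mul_le_mul_right (NNReal.rpow_le_rpow ?_ hα) _
    rwa [← ENNReal.coe_le_coe, ENNReal.coe_toNNReal (hfin u v)]
  · rw [upperModulus, mul_assoc, ← NNReal.mul_rpow]
    refine mul_le_mul_right (NNReal.rpow_le_rpow ?_ hα) _
    rw [← ENNReal.coe_le_coe, ENNReal.coe_toNNReal (hfin u v)]
    simpa using h2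

end WreathProduct

/-! ### Coarse embeddings -/

section CompressionBounds

variable {Γ : Type*} [Group Γ] {S : Set Γ} {ψ : Γ → LpSpace 1} {ρ₁ ρ₂ : ℝ≥0 → ℝ≥0}

theorem HasCompressionBounds.le_enorm_sub (h : HasCompressionBounds (wordDist S) ψ ρ₁ ρ₂)
    (x y : Γ) : (ρ₁ (wordDist S x y) : ℝ≥0∞) ≤ ‖ψ x - ψ y‖ₑ :=
  ENNReal.coe_le_coe.2 (h x y).1

theorem HasCompressionBounds.enorm_sub_mul_le (h : HasCompressionBounds (wordDist S) ψ ρ₁ ρ₂)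
    (hρ₂ : Monotone ρ₂) (x : Γ) {a : Γ} (ha : a ∈ S) : ‖ψ x - ψ (x * a)‖ₑ ≤ ρ₂ 1 := by
  refine ENNReal.coe_le_coe.2 ((h x (x * a)).2.trans (hρ₂ ?_))
  have := wordLength_le_one ha
  simp only [wordDist, inv_mul_cancel_left]
  exact_mod_cast this

open scoped Classical in
/-- The modulus `ρ` raised by `1` on `[1, ∞)`. It is positive at `1`, and it is the lower modulus of
an embedding with lower modulus `ρ` to which the discrete kernel is added. -/
noncomputable def raisedModulus (ρ : ℝ≥0 → ℝ≥0) (t : ℝ≥0) : ℝ≥0 := ρ t + if 1 ≤ t then 1 else 0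

theorem isModulus_raisedModulus {ρ : ℝ≥0 → ℝ≥0} (hρ : IsModulus ρ) :
    IsModulus (raisedModulus ρ) := by
  refine ⟨fun a b hab => add_le_add (hρ.1 hab) ?_, fun ⟨B, hB⟩ => hρ.2 ⟨B, ?_⟩⟩
  · split_ifs with h1 h2
    · exact le_rfl
    · exact absurd (h1.trans hab) h2
    · simp
    · exact le_rfl
  · rintro _ ⟨t, rfl⟩
    exact le_self_add.trans (hB ⟨t, rfl⟩)

theorem raisedModulus_one_pos (ρ : ℝ≥0 → ℝ≥0) : 0 < raisedModulus ρ 1 := by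
  simp [raisedModulus]

theorem HasCompressionBounds.raisedModulus_le (h : HasCompressionBounds (wordDist S) ψ ρ₁ ρ₂)
    (x y : Γ) :
    (raisedModulus ρ₁ (wordDist S x y) : ℝ≥0∞) ≤ ‖ψ x - ψ y‖ₑ + discreteKernel x y := by
  unfold raisedModulus
  push_cast
  refine add_le_add (h.le_enorm_sub x y) ?_
  rcases eq_or_ne x y with rfl | hxy
  · simp [wordDist_self]
  · unfold discreteKernel
    rw [if_neg hxy]
    split_ifs <;> simp

theorem HasCompressionBounds.enorm_sub_add_discreteKernel_le
    (h : HasCompressionBounds (wordDist S) ψ ρ₁ ρ₂) (hρ₂ : Monotone ρ₂) (x : Γ) (a : Γ)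
    (ha : a ∈ S) : ‖ψ x - ψ (x * a)‖ₑ + discreteKernel x (x * a) ≤ (ρ₂ 1 + 2 : ℝ≥0) := by
  push_cast
  exact add_le_add (h.enorm_sub_mul_le hρ₂ x ha) (discreteKernel_le_two _ _)

end CompressionBounds

/-- A function on the integers is extended to `ℝ≥0` as a step function. -/
theorem isModulus_floor {ν : ℕ → ℝ≥0} (hν : Monotone ν) (hν' : ¬ BddAbove (Set.range ν)) {c : ℝ≥0}
    (hc : 0 < c) : IsModulus fun t => c * ν ⌊t⌋₊ := by
  refine ⟨fun a b hab => mul_le_mul_right (hν (Nat.floor_mono hab)) _, fun ⟨B, hB⟩ =>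
    hν' ⟨B / c, ?_⟩⟩
  rintro _ ⟨n, rfl⟩
  have := hB ⟨(n : ℝ≥0), rfl⟩
  rw [le_div_iff₀ hc, mul_comm]
  simpa using this

theorem monotone_upperModulus (p : ℝ≥0∞) : Monotone (upperModulus p) := fun _ _ h =>
  NNReal.rpow_le_rpow (by exact_mod_cast h) (compressionExponent_pos p).le

theorem not_bddAbove_range_upperModulus (p : ℝ≥0∞) : ¬ BddAbove (Set.range (upperModulus p)) := by
  rintro ⟨B, hB⟩
  obtain ⟨n, hn⟩ := exists_nat_gt (B ^ (compressionExponent p)⁻¹)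
  refine hn.not_ge ?_
  rw [NNReal.le_rpow_inv_iff (compressionExponent_pos p)]
  exact hB ⟨n, rfl⟩

/-- The lower moduli are raised first, because a lower modulus that vanishes at `1` may lead to a
bounded lower modulus on the wreath product. -/
theorem WreathProduct.coarselyEmbeds {G H : Type*} [Group G] [Group H] {S : Set G} {T : Set H}
    (hSfin : S.Finite) (hS : Subgroup.closure S = ⊤) (hTfin : T.Finite)
    (hT : Subgroup.closure T = ⊤) (p : ℝ≥0∞) [Fact (1 ≤ p)] (hp : p ≠ ∞)
    (hG : CoarselyEmbeds (wordDist S) (LpSpace 1)) (hH : CoarselyEmbeds (wordDist T) (LpSpace 1)) :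
    CoarselyEmbeds (wordDist (wreathGenerators S T)) (LpSpace p) := by
  obtain ⟨φ, τ₁, τ₂, hτ₁, hτ₂, hφ⟩ := hG
  obtain ⟨ψ, ρ₁, ρ₂, hρ₁, hρ₂, hψ⟩ := hH
  have := countable_of_closure_eq_top hSfin hS
  have := countable_of_closure_eq_top hTfin hT
  have hρ := isModulus_raisedModulus hρ₁
  have hτ := isModulus_raisedModulus hτ₁
  obtain ⟨Φ, c, C, hc, hC, hΦ⟩ := exists_embedding hSfin hS hTfin hT p hp hρ.1 hτ.1
    ((isCutKernel_enorm_sub ψ).add isCutKernel_discreteKernel)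
    ((isCutKernel_enorm_sub φ).add isCutKernel_discreteKernel)
    (hψ.enorm_sub_add_discreteKernel_le hρ₂.1) (hφ.enorm_sub_add_discreteKernel_le hτ₂.1)
    hψ.raisedModulus_le hφ.raisedModulus_le
  refine ⟨Φ, _, _, isModulus_floor (monotone_lowerModulus p hρ.1 hτ.1)
    (not_bddAbove_range_lowerModulus p hρ hτ (raisedModulus_one_pos _) (raisedModulus_one_pos _))
    hc, isModulus_floor (monotone_upperModulus p) (not_bddAbove_range_upperModulus p) hC,
    fun u v => ?_⟩
  simpa using hΦ u v

theorem theorem1p2 {G H : Type*} [Group G] [Group H]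
    (S : Set G) (hSfin : S.Finite) (hS : Subgroup.closure S = ⊤)
    (T : Set H) (hTfin : T.Finite) (hT : Subgroup.closure T = ⊤)
    (p : ℝ≥0∞) [Fact (1 ≤ p)] (hp : p ≠ ∞) :
    (CoarselyEmbeds (wordDist S) (LpSpace 1) → CoarselyEmbeds (wordDist T) (LpSpace 1) →
      CoarselyEmbeds (wordDist (wreathGenerators S T)) (LpSpace p)) ∧
    (∀ (ρ₁ ρ₂ τ₁ τ₂ : ℝ≥0 → ℝ≥0) (ψ : H → LpSpace 1) (φ : G → LpSpace 1),
      IsModulus ρ₁ → IsModulus ρ₂ → IsModulus τ₁ → IsModulus τ₂ →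
      HasCompressionBounds (wordDist T) ψ ρ₁ ρ₂ →
      HasCompressionBounds (wordDist S) φ τ₁ τ₂ →
      (∃ (Φ : WreathProduct G H → LpSpace p) (c C : ℝ≥0), 0 < c ∧ 0 < C ∧
        ∀ u v : WreathProduct G H,
          c * lowerModulus p ρ₁ τ₁ (wordDist (wreathGenerators S T) u v) ≤ ‖Φ u - Φ v‖₊ ∧
          ‖Φ u - Φ v‖₊ ≤ C * upperModulus p (wordDist (wreathGenerators S T) u v)) ∧
      Monotone (lowerModulus p ρ₁ τ₁) ∧
      (0 < ρ₁ 1 → 0 < τ₁ 1 → ¬ BddAbove (Set.range (lowerModulus p ρ₁ τ₁))) ∧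
      (StrictMono ρ₁ → StrictMono τ₁ →
        StrictMono (lowerModulus p ρ₁ τ₁) ∧
        ¬ BddAbove (Set.range (lowerModulus p ρ₁ τ₁)))) := by
  refine ⟨WreathProduct.coarselyEmbeds hSfin hS hTfin hT p hp, ?_⟩
  intro ρ₁ ρ₂ τ₁ τ₂ ψ φ hρ₁ hρ₂ hτ₁ hτ₂ hψ hφ
  refine ⟨WreathProduct.exists_embedding hSfin hS hTfin hT p hp hρ₁.1 hτ₁.1
    (isCutKernel_enorm_sub ψ) (isCutKernel_enorm_sub φ)
    (fun x t ht => hψ.enorm_sub_mul_le hρ₂.1 x ht) (fun x s hs => hφ.enorm_sub_mul_le hτ₂.1 x hs)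
    hψ.le_enorm_sub hφ.le_enorm_sub, monotone_lowerModulus p hρ₁.1 hτ₁.1,
    not_bddAbove_range_lowerModulus p hρ₁ hτ₁, fun hρ hτ => ⟨strictMono_lowerModulus p hρ hτ,
    not_bddAbove_range_lowerModulus p hρ₁ hτ₁ (pos_of_gt (hρ zero_lt_one))
      (pos_of_gt (hτ zero_lt_one))⟩⟩
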